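/- Theorem (continuity). Let $N\ge 0$ be an integer, let $\beta>-1$ be real, and let $\lambda_0,\dots,\lambda_{2N+1}$ be real numbers, not necessarily distinct or ordered, with $\lambda_n+\beta/2>-1/2$ for $n=0,\dots,2N+1$. For real numbers $\Lambda=\{\mu_0,\dots,\mu_{2N+1}\}$ with $\mu_n+\beta/2>-1/2$, for $0\le n\le 2N+1$ and $x>0$, define the Müntz–Jacobi polynomials $$L_n^\beta(x;\Lambda)=\frac{x^{-\beta/2}}{2\pi i}\int_{\Gamma}\prod_{k=0}^{n-1}\frac{t+\mu_k+\beta/2+1}{t-\mu_k-\beta/2}\,\frac{x^t}{t-\mu_n-\beta/2}\,dt,$$ where $\Gamma$ is a positively oriented circle enclosing $\mu_0+\beta/2,\dots,\mu_n+\beta/2$. A Gauss rule for $\Lambda$ with weight function $x^\beta$ consists of nodes $0<x_0<\dots<x_N<1$ and weights $\omega_0,\dots,\omega_N>0$ such that, with convergent integrals, $$\sum_{k=0}^N L_n^\beta(x_k;\Lambda)\,\omega_k=\int_0^1 L_n^\beta(x;\Lambda)\,x^\beta\,dx,\qquad n=0,1,\dots,2N+1.$$ For $\alpha\in[0,1]$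 put $\lambda_n^{(\alpha)}=\alpha\lambda_n+(1-\alpha)n$ and $\Lambda^{(\alpha)}=\{\lambda_0^{(\alpha)},\dots,\lambda_{2N+1}^{(\alpha)}\}$. Then for every $\alpha\in[0,1]$ there is exactly one Gauss rule $x_k(\alpha),\omega_k(\alpha)$ $(0\le k\le N)$ for $\Lambda^{(\alpha)}$ with weight function $x^\beta$, and every $x_k(\alpha)$ and every $\omega_k(\alpha)$ is a continuous function of $\alpha$ on $[0,1]$. At $\alpha=0$ the rule is the classical $(N+1)$-point Gauss–Jacobi rule on $[0,1]$ with weight function $x^\beta$: its nodes are the zeros of the polynomial of degree $N+1$ that is orthogonal, with respect to $x^\beta\,dx$ on $[0,1]$, to all polynomials of degree at most $N$, and $\omega_k(0)=\int_0^1\ell_k(x)\,x^\beta\,dx$, where $\ell_k$ are the Lagrange basis polynomials at these nodes. At $\alpha=1$ it is the Gauss rule for the given sequence $\lambda_0,\dots,\lambda_{2N+1}$. -/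

import Mathlib

noncomputable section

/-- The rational function
`W_n(t) = ∏_{k<n} (t + conj λ_k + 1) / (t - λ_k) * 1 / (t - λ_n)`. -/
def muntzW (lam : ℕ → ℂ) (n : ℕ) (t : ℂ) : ℂ :=
  (∏ k ∈ Finset.range n, (t + (starRingEnd ℂ) (lam k) + 1) / (t - lam k)) * (1 / (t - lam n))

/-- The Müntz–Legendre polynomial `L_n(x; λ_0, …, λ_n) = (2πi)⁻¹ ∮ W_n(t) x^t dt` for `x > 0`.
The contour is the positively oriented circle about `0` of radius `1 + ∑_{k≤n} |λ_k|`, which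
encircles `λ_0, …, λ_n`. The exponents may be repeated. -/
def muntzLegendre (lam : ℕ → ℂ) (n : ℕ) (x : ℝ) : ℂ :=
  (2 * (Real.pi : ℂ) * Complex.I)⁻¹ *
    ∮ t in C(0, 1 + ∑ k ∈ Finset.range (n + 1), ‖lam k‖), muntzW lam n t * (x : ℂ) ^ t

/-- The Müntz–Jacobi polynomial `L_n^β(x; Λ) = x^(-β/2) L_n(x; Λ + β/2)` of a real sequence. -/
def muntzJacobi (β : ℝ) (lam : ℕ → ℝ) (n : ℕ) (x : ℝ) : ℂ :=
  ((x ^ (-β / 2) : ℝ) : ℂ) * muntzLegendre (fun k => ((lam k + β / 2 : ℝ) : ℂ)) n x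

/-- The moment `m_n = ∫_0^1 L_n^β(x; Λ) x^β dx`. -/
def muntzMoment (β : ℝ) (lam : ℕ → ℝ) (n : ℕ) : ℂ :=
  ∫ x in (0 : ℝ)..1, muntzJacobi β lam n x * ((x ^ β : ℝ) : ℂ)

/-- `x_0 < … < x_N` in `(0,1)` and positive `w_0, …, w_N` are the nodes and weights of the
Gauss rule with weight function `x^β` for the sequence `λ_0, …, λ_{2N+1}`: the integrals
`∫_0^1 L_n^β(x) x^β dx` converge and the rule is exact for `L_0^β, …, L_{2N+1}^β`. -/
structure IsMuntzGaussRule (N : ℕ) (β : ℝ) (lam : ℕ → ℝ) (x w : Fin (N + 1) → ℝ) : Prop where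
  node_mem : ∀ k, x k ∈ Set.Ioo (0 : ℝ) 1
  node_strictMono : StrictMono x
  weight_pos : ∀ k, 0 < w k
  integrable : ∀ n ≤ 2 * N + 1, IntervalIntegrable
    (fun t : ℝ => muntzJacobi β lam n t * ((t ^ β : ℝ) : ℂ)) MeasureTheory.volume 0 1
  exact : ∀ n ≤ 2 * N + 1,
    ∑ k, muntzJacobi β lam n (x k) * ((w k : ℝ) : ℂ) = muntzMoment β lam n

/-- The classical `(N+1)`-point Gauss–Jacobi rule on `[0,1]` with weight function `x^β`: the nodes
are the zeros of the orthogonal polynomial of degree `N + 1` with respect to `x^β`, and the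
weights are those of polynomial interpolation at the nodes. -/
structure IsGaussJacobiRule (N : ℕ) (β : ℝ) (x w : Fin (N + 1) → ℝ) : Prop where
  node_injective : Function.Injective x
  node_zeros : ∃ P : Polynomial ℝ, P.natDegree = N + 1 ∧
    (∀ q : Polynomial ℝ, q.natDegree ≤ N →
      ∫ t in (0 : ℝ)..1, P.eval t * q.eval t * t ^ β = 0) ∧
    P.roots = Finset.univ.val.map x
  weight_eq : ∀ k, w k = ∫ t in (0 : ℝ)..1, (Lagrange.basis Finset.univ x k).eval t * t ^ β

/-- The homotopy `λ_n^(α) = α λ_n + (1 - α) n`. -/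
def muntzHomotopy (lam : ℕ → ℝ) (α : ℝ) (n : ℕ) : ℝ :=
  α * lam n + (1 - α) * (n : ℝ)

end

open Filter Topology

noncomputable section

/-! Put `s = log x` and `ν k = lam k + β / 2`. Up to the factor `x ^ (-β / 2)`, the Müntz–Jacobi
polynomials become combinations of the divided differences of `t ↦ exp (t * s)` at `ν 0, …, ν j`.
The change of basis is triangular, with diagonal `∏ (ν n + ν k + 1) ≠ 0` since all exponents exceed
`-1/2`. So a Gauss rule amounts to nodes `s k < 0` and weights `w k * x k ^ (-β / 2) > 0`
reproducing the moments of `x ^ (β / 2) dx` on this basis (`isMuntzGaussRule_iff`). The basis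
depends continuously on the exponents even when they collide, so repetitions and crossings along the
homotopy are harmless.

The rest is Krein's theory of Chebyshev systems. By Rolle's theorem a nonzero element of the
`n`-dimensional space has fewer than `n` zeros. Hence a rule is determined by its moments
(`injOn_quadMoments`), and the moment map is open, a kernel of its transposed derivative having `N +
1` double zeros (`map_nhds_quadMoments`). It is also proper: if moments converge to a functional
that is positive on nonnegative functions, the rules cannot degenerate, because each degeneration
yields a nonzero nonnegative function with zero moment (`exists_tendsto_of_tendsto_quadMoments`).

Openness and properness give existence by continuation along a segment of moments
(`exists_quadMoments_eq`). Properness and uniqueness give continuity in `α`, since the moments are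
continuous by dominated convergence. At `α = 0` exactness on the powers up to degree `2 N + 1`
forces the Gauss–Jacobi rule. -/

/-! ### Divided differences and exponential polynomials. -/

/-- The divided difference of `t ↦ exp (t * s)` at the exponents `ν 0, …, ν j`, built by
variation of constants. -/
def expDivDiff : ℕ → (ℕ → ℝ) → ℝ → ℝ
  | 0, ν, s => Real.exp (ν 0 * s)
  | j + 1, ν, s => ∫ u in (0 : ℝ)..s, Real.exp (ν 0 * (s - u)) * expDivDiff j (fun k => ν (k + 1)) u

/-- The exponential polynomial with coefficients `c` in the basis of divided differences. -/
def expPoly (n : ℕ) (ν : ℕ → ℝ) (c : Fin n → ℝ) (s : ℝ) : ℝ :=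
  ∑ j : Fin n, c j * expDivDiff j ν s

theorem continuous_expDivDiff (j : ℕ) :
    Continuous fun p : (ℕ → ℝ) × ℝ => expDivDiff j p.1 p.2 := by
  induction j with
  | zero => simp only [expDivDiff]; fun_prop
  | succ j ih =>
    simp only [expDivDiff]
    refine intervalIntegral.continuous_parametric_intervalIntegral_of_continuous
      (f := fun (p : (ℕ → ℝ) × ℝ) u =>
        Real.exp (p.1 0 * (p.2 - u)) * expDivDiff j (fun k => p.1 (k + 1)) u) ?_ continuous_snd
    refine Continuous.mul (by fun_prop) ?_
    exact ih.comp (f := fun q : ((ℕ → ℝ) × ℝ) × ℝ => ((fun k => q.1.1 (k + 1)), q.2))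
      (by fun_prop)

theorem continuous_expDivDiff_right (j : ℕ) (ν : ℕ → ℝ) : Continuous (expDivDiff j ν) :=
  (continuous_expDivDiff j).comp (f := fun s : ℝ => (ν, s)) (by fun_prop)

theorem expDivDiff_succ_eq (j : ℕ) (ν : ℕ → ℝ) (s : ℝ) :
    expDivDiff (j + 1) ν s = Real.exp (ν 0 * s) *
      ∫ u in (0 : ℝ)..s, Real.exp (-(ν 0 * u)) * expDivDiff j (fun k => ν (k + 1)) u := by
  rw [← intervalIntegral.integral_const_mul]
  simp only [expDivDiff]
  congr 1 with u
  rw [← mul_assoc, ← Real.exp_add]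
  ring_nf

theorem hasDerivAt_exp_mul (a s : ℝ) :
    HasDerivAt (fun s => Real.exp (a * s)) (a * Real.exp (a * s)) s := by
  simpa [mul_comm] using ((hasDerivAt_id s).const_mul a).exp

theorem hasDerivAt_expDivDiff_zero (ν : ℕ → ℝ) (s : ℝ) :
    HasDerivAt (expDivDiff 0 ν) (ν 0 * expDivDiff 0 ν s) s :=
  hasDerivAt_exp_mul _ _

/-- The operator `d/ds - ν 0` strips off the first exponent. This recursion drives all the
inductions on the dimension. -/
theorem hasDerivAt_expDivDiff_succ (j : ℕ) (ν : ℕ → ℝ) (s : ℝ) :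
    HasDerivAt (expDivDiff (j + 1) ν)
      (ν 0 * expDivDiff (j + 1) ν s + expDivDiff j (fun k => ν (k + 1)) s) s := by
  have hc : Continuous fun u => Real.exp (-(ν 0 * u)) * expDivDiff j (fun k => ν (k + 1)) u := by
    have := continuous_expDivDiff_right j (fun k => ν (k + 1))
    fun_prop
  have h := (hasDerivAt_exp_mul (ν 0) s).mul
    (intervalIntegral.integral_hasDerivAt_right (hc.intervalIntegrable 0 s)
      (hc.stronglyMeasurableAtFilter _ _) hc.continuousAt)
  have he : Real.exp (ν 0 * s) * Real.exp (-(ν 0 * s)) = 1 := by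
    rw [← Real.exp_add]; simp
  rw [show expDivDiff (j + 1) ν = _ from funext (expDivDiff_succ_eq j ν)]
  refine h.congr_deriv ?_
  rw [mul_assoc, ← mul_assoc (Real.exp (ν 0 * s)) (Real.exp (-(ν 0 * s))), he, one_mul]

theorem continuous_expPoly (n : ℕ) :
    Continuous fun p : (ℕ → ℝ) × (Fin n → ℝ) × ℝ => expPoly n p.1 p.2.1 p.2.2 := by
  unfold expPoly
  refine continuous_finsetSum _ fun j _ => Continuous.mul (by fun_prop) ?_
  exact (continuous_expDivDiff j).comp
    (f := fun p : (ℕ → ℝ) × (Fin n → ℝ) × ℝ => (p.1, p.2.2)) (by fun_prop)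

theorem continuous_expPoly_right (n : ℕ) (ν : ℕ → ℝ) (c : Fin n → ℝ) :
    Continuous (expPoly n ν c) :=
  (continuous_expPoly n).comp (f := fun s : ℝ => (ν, c, s)) (by fun_prop)

theorem expPoly_smul {n : ℕ} (ν : ℕ → ℝ) (a : ℝ) (c : Fin n → ℝ) (s : ℝ) :
    expPoly n ν (a • c) s = a * expPoly n ν c s := by
  simp [expPoly, Finset.mul_sum, mul_assoc]

theorem expPoly_succ {n : ℕ} (ν : ℕ → ℝ) (c : Fin (n + 1) → ℝ) (s : ℝ) :
    expPoly (n + 1) ν c s = c 0 * Real.exp (ν 0 * s) +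
      ∑ j : Fin n, c j.succ * expDivDiff (j + 1) ν s := by
  simp [expPoly, Fin.sum_univ_succ, expDivDiff]

theorem hasDerivAt_expPoly {n : ℕ} (ν : ℕ → ℝ) (c : Fin (n + 1) → ℝ) (s : ℝ) :
    HasDerivAt (expPoly (n + 1) ν c)
      (ν 0 * expPoly (n + 1) ν c s + expPoly n (fun k => ν (k + 1)) (Fin.tail c) s) s := by
  have h := ((hasDerivAt_exp_mul (ν 0) s).const_mul (c 0)).add
    (HasDerivAt.fun_sum (u := Finset.univ) fun (j : Fin n) _ =>
      (hasDerivAt_expDivDiff_succ j ν s).const_mul (c j.succ))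
  rw [show expPoly (n + 1) ν c = _ from funext (expPoly_succ ν c)]
  refine h.congr_deriv ?_
  simp only [mul_add, Finset.sum_add_distrib, expPoly, Fin.tail, Finset.mul_sum]
  rw [← add_assoc]
  congr 2
  · ring
  · exact Finset.sum_congr rfl fun j _ => by ring

/-! ### Zeros and sign changes. -/

theorem hasDerivAt_exp_neg_mul_expPoly {n : ℕ} (ν : ℕ → ℝ) (c : Fin (n + 1) → ℝ) (s : ℝ) :
    HasDerivAt (fun s => Real.exp (-ν 0 * s) * expPoly (n + 1) ν c s)
      (Real.exp (-ν 0 * s) * expPoly n (fun k => ν (k + 1)) (Fin.tail c) s) s :=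
  ((hasDerivAt_exp_mul (-ν 0) s).mul (hasDerivAt_expPoly ν c s)).congr_deriv (by ring)

theorem expPoly_of_tail_eq_zero {n : ℕ} (ν : ℕ → ℝ) (c : Fin (n + 1) → ℝ) (h : Fin.tail c = 0)
    (s : ℝ) : expPoly (n + 1) ν c s = c 0 * Real.exp (ν 0 * s) := by
  rw [expPoly_succ]
  have (j : Fin n) : c j.succ = 0 := congrFun h j
  simp [this]

theorem eq_zero_of_tail_eq_zero {n : ℕ} (c : Fin (n + 1) → ℝ) (h : Fin.tail c = 0) (h0 : c 0 = 0) :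
    c = 0 := by
  ext j
  refine Fin.cases h0 (fun j => congrFun h j) j

/-- The Rolle step: after multiplication by `exp (-ν 0 * s)`, the derivative lies in a space of
dimension one less, up to a positive factor. -/
theorem exists_mem_Ioo_expPoly_tail {n : ℕ} (ν : ℕ → ℝ) (c : Fin (n + 1) → ℝ) {a b : ℝ}
    (hab : a < b) : ∃ ξ ∈ Set.Ioo a b,
      Real.exp (-ν 0 * ξ) * expPoly n (fun k => ν (k + 1)) (Fin.tail c) ξ =
        (Real.exp (-ν 0 * b) * expPoly (n + 1) ν c b -
          Real.exp (-ν 0 * a) * expPoly (n + 1) ν c a) / (b - a) :=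
  exists_hasDerivAt_eq_slope _ _ hab
    (fun s _ => (hasDerivAt_exp_neg_mul_expPoly ν c s).continuousAt.continuousWithinAt)
    fun s _ => hasDerivAt_exp_neg_mul_expPoly ν c s

/-- An exponential polynomial from an `n`-dimensional space that weakly alternates in sign at
`n + 1` points vanishes. -/
theorem expPoly_eq_zero_of_alternating (n : ℕ) : ∀ (ν : ℕ → ℝ) (c : Fin n → ℝ)
    (t : Fin (n + 1) → ℝ), StrictMono t → (∀ i : Fin (n + 1), 0 ≤ (-1) ^ (i : ℕ) * expPoly n ν c (t i)) →
      c = 0 := by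
  induction n with
  | zero => intro ν c t _ _; exact Subsingleton.elim _ _
  | succ n ih =>
    intro ν c t ht h
    have hE (i : Fin (n + 2)) : 0 ≤ (-1) ^ (i : ℕ) *
        (Real.exp (-ν 0 * t i) * expPoly (n + 1) ν c (t i)) := by
      have := mul_nonneg (Real.exp_pos (-ν 0 * t i)).le (h i)
      linarith
    choose ξ hξ hd using fun i : Fin (n + 1) =>
      exists_mem_Ioo_expPoly_tail ν c (ht (Fin.castSucc_lt_succ (i := i)))
    have hmono : StrictMono ξ := by
      refine Fin.strictMono_iff_lt_succ.2 fun i => ?_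
      have h1 := (hξ i.castSucc).2
      have h2 := (hξ i.succ).1
      rw [Fin.succ_castSucc] at h1
      exact h1.trans h2
    have htail : Fin.tail c = 0 := by
      -- The slope between `t i` and its successor has the sign opposite to that at `t i`; the
      -- factor `-1` restores the pattern starting with `+`.
      have := ih (fun k => ν (k + 1)) ((-1 : ℝ) • Fin.tail c) ξ hmono fun i => by
        have h1 := hE i.castSucc
        have h2 := hE i.succ
        have hp : 0 < t i.succ - t i.castSucc := sub_pos.2 (ht Fin.castSucc_lt_succ)
        have key : 0 ≤ Real.exp (-ν 0 * ξ i) * ((-1) ^ (i : ℕ) *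
            expPoly n (fun k => ν (k + 1)) ((-1 : ℝ) • Fin.tail c) (ξ i)) := by
          rw [expPoly_smul]
          have := hd i
          rw [show Real.exp (-ν 0 * ξ i) * ((-1) ^ (i : ℕ) * (-1 *
            expPoly n (fun k => ν (k + 1)) (Fin.tail c) (ξ i))) = -(-1) ^ (i : ℕ) *
            (Real.exp (-ν 0 * ξ i) * expPoly n (fun k => ν (k + 1)) (Fin.tail c) (ξ i)) by ring,
            this, mul_div_assoc']
          refine div_nonneg ?_ hp.le
          simp only [Fin.val_castSucc, Fin.val_succ, pow_succ] at h1 h2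
          linarith
        exact nonneg_of_mul_nonneg_right key (Real.exp_pos _)
      simpa using this
    refine eq_zero_of_tail_eq_zero c htail ?_
    have h0 := h 0
    have h1 := h 1
    rw [expPoly_of_tail_eq_zero ν c htail] at h0 h1
    have e0 := Real.exp_pos (ν 0 * t 0)
    have e1 := Real.exp_pos (ν 0 * t 1)
    simp only [Fin.val_zero, pow_zero, one_mul, Fin.val_one, pow_one] at h0 h1
    have : 0 ≤ c 0 := nonneg_of_mul_nonneg_left h0 e0
    have : 0 ≤ -c 0 := nonneg_of_mul_nonneg_left (by linarith) e1
    linarith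

/-- One factor is negative for each of the `n - i` larger points, and `n - i` has the parity of `n +
i`. -/
theorem neg_one_pow_mul_prod_sub_pos {n : ℕ} {t : Fin (n + 1) → ℝ} (ht : StrictMono t)
    (i : Fin (n + 1)) : 0 < (-1) ^ (n + i : ℕ) * ∏ j ∈ Finset.univ.erase i, (t i - t j) := by
  have h1 : ∏ j ∈ Finset.univ.erase i, (t i - t j) =
      (∏ j ∈ Finset.univ.erase i, if i < j then (-1 : ℝ) else 1) *
        ∏ j ∈ Finset.univ.erase i, |t i - t j| := by
    rw [← Finset.prod_mul_distrib]
    refine Finset.prod_congr rfl fun j hj => ?_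
    rcases lt_or_gt_of_ne (Finset.ne_of_mem_erase hj) with h | h
    · rw [if_neg h.not_gt, abs_of_pos (sub_pos.2 (ht h)), one_mul]
    · rw [if_pos h, abs_of_neg (sub_neg.2 (ht h))]; ring
  have h2 : (∏ j ∈ Finset.univ.erase i, if i < j then (-1 : ℝ) else 1) = (-1) ^ (n - i : ℕ) := by
    rw [Finset.prod_ite, Finset.prod_const, Finset.prod_const_one, mul_one]
    congr 1
    rw [show (Finset.univ.erase i).filter (fun j => i < j) = Finset.Ioi i by
      ext j
      simp only [Finset.mem_filter, Finset.mem_erase, Finset.mem_univ, Finset.mem_Ioi]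
      exact ⟨fun h => h.2, fun h => ⟨⟨h.ne', trivial⟩, h⟩⟩, Fin.card_Ioi]
    simp
  have h3 : 0 < ∏ j ∈ Finset.univ.erase i, |t i - t j| := Finset.prod_pos fun j hj =>
    abs_pos.2 (sub_ne_zero.2 (ht.injective.ne (Finset.ne_of_mem_erase hj).symm))
  rw [h1, h2, ← mul_assoc, ← pow_add,
    show n + i + (n - i : ℕ) = 2 * n by have := i.2; omega, pow_mul]
  simpa using h3

/-- An order-free form of the alternation criterion: the products `∏ (t - t')` alternate in sign
along `T`. -/
theorem expPoly_eq_zero_of_mul_prod_nonneg {n : ℕ} (ν : ℕ → ℝ) (c : Fin n → ℝ) (T : Finset ℝ)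
    (hT : T.card = n + 1)
    (h : ∀ t ∈ T, 0 ≤ expPoly n ν c t * ∏ t' ∈ T.erase t, (t - t')) : c = 0 := by
  set e := T.orderEmbOfFin hT
  have := expPoly_eq_zero_of_alternating n ν ((-1 : ℝ) ^ n • c) e e.strictMono fun i => by
    have h1 := h (e i) (T.orderEmbOfFin_mem hT i)
    have h2 := neg_one_pow_mul_prod_sub_pos e.strictMono i
    have h3 : ∏ t' ∈ T.erase (e i), (e i - t') = ∏ j ∈ Finset.univ.erase i, (e i - e j) := by
      have : T.erase (e i) = (Finset.univ.erase i).map e.toEmbedding := by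
        rw [Finset.map_erase, Finset.map_orderEmbOfFin_univ]; rfl
      rw [this, Finset.prod_map]; rfl
    rw [h3] at h1
    set P := ∏ j ∈ Finset.univ.erase i, (e i - e j)
    rw [expPoly_smul]
    have h4 : ((-1 : ℝ) ^ (n + i : ℕ)) * (-1) ^ (n + i : ℕ) = 1 := by
      rw [← mul_pow]; simp
    have h5 : 0 ≤ ((-1) ^ (n + i : ℕ) * expPoly n ν c (e i)) * ((-1) ^ (n + i : ℕ) * P) := by
      calc 0 ≤ expPoly n ν c (e i) * P := h1
        _ = ((-1 : ℝ) ^ (n + i : ℕ)) * (-1) ^ (n + i : ℕ) * (expPoly n ν c (e i) * P) := by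
          rw [h4, one_mul]
        _ = _ := by ring
    have h6 := nonneg_of_mul_nonneg_left h5 h2
    rw [pow_add] at h6
    linarith
  exact (smul_eq_zero.1 this).resolve_left (pow_ne_zero _ (by norm_num))

/-- An exponential polynomial from an `n`-dimensional space with `n` zeros vanishes. -/
theorem expPoly_eq_zero_of_zeros {n : ℕ} (ν : ℕ → ℝ) (c : Fin n → ℝ) (T : Finset ℝ)
    (hT : n ≤ T.card) (h : ∀ t ∈ T, expPoly n ν c t = 0) : c = 0 := by
  obtain ⟨T', hT', hc⟩ := Finset.exists_subset_card_eq hT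
  -- With one more point `b`, the zeros alternate weakly with whatever sign occurs at `b`, after
  -- replacing `c` by `-c` if needed.
  obtain ⟨b, hb⟩ := Infinite.exists_notMem_finset T'
  have h' : ∀ t ∈ T', expPoly n ν c t = 0 := fun t ht => h t (hT' ht)
  have key (a : ℝ) (ha : 0 ≤ a * (expPoly n ν c b * ∏ t' ∈ T', (b - t'))) : a • c = 0 := by
    refine expPoly_eq_zero_of_mul_prod_nonneg ν (a • c) (insert b T')
      (by rw [Finset.card_insert_of_notMem hb, hc]) fun t ht => ?_
    rw [expPoly_smul]
    rcases Finset.mem_insert.1 ht with rfl | ht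
    · rw [Finset.erase_insert hb, mul_assoc]; exact ha
    · simp [h' t ht]
  rcases le_total 0 (expPoly n ν c b * ∏ t' ∈ T', (b - t')) with h0 | h0
  · simpa using key 1 (by simpa using h0)
  · simpa using key (-1) (by simpa using h0)

theorem exists_expPoly_zeros {n : ℕ} {ι : Type*} [Fintype ι] (hι : Fintype.card ι < n) (ν : ℕ → ℝ)
    (z : ι → ℝ) : ∃ c : Fin n → ℝ, c ≠ 0 ∧ ∀ i, expPoly n ν c (z i) = 0 := by
  let L : (Fin n → ℝ) →ₗ[ℝ] (ι → ℝ) :=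
    LinearMap.pi fun i => ∑ j : Fin n, expDivDiff j ν (z i) • LinearMap.proj j
  have hL : L.ker ≠ ⊥ := LinearMap.ker_ne_bot_of_finrank_lt (by simpa using hι)
  obtain ⟨c, hc, h0⟩ := (Submodule.ne_bot_iff _).1 hL
  refine ⟨c, h0, fun i => ?_⟩
  have := congrFun (LinearMap.mem_ker.1 hc) i
  simpa [L, expPoly, mul_comm] using this

/-- A dimension count gives a nonzero `F` with these `n - 1` zeros. If `F * ∏ (s - z i)` had
opposite signs at `a` and `b`, then `±F` would weakly alternate on the `n + 1` points formed by the
zeros, `a` and `b`, so `F` would vanish. -/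
theorem exists_expPoly_mul_prod_nonneg_of_injective {n : ℕ} {ι : Type*} [Fintype ι]
    (hι : Fintype.card ι + 1 = n) (ν : ℕ → ℝ) (z : ι → ℝ) (hz : Function.Injective z) :
    ∃ c ∈ Metric.sphere (0 : Fin n → ℝ) 1, (∀ i, expPoly n ν c (z i) = 0) ∧
      ∀ s, 0 ≤ expPoly n ν c s * ∏ i, (s - z i) := by
  classical
  obtain ⟨c, hc0, hc⟩ := exists_expPoly_zeros (n := n) (by omega) ν z
  set P : ℝ → ℝ := fun s => ∏ i, (s - z i)
  set f : ℝ → ℝ := fun s => expPoly n ν c s * P s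
  have key (a b : ℝ) (hlt : f a * f b < 0) : False := by
    have hfa : f a ≠ 0 := fun h => by simp [h] at hlt
    have hfb : f b ≠ 0 := fun h => by simp [h] at hlt
    have hnot (x : ℝ) (hx : f x ≠ 0) : x ∉ Finset.univ.image z := by
      intro hm
      obtain ⟨i, -, rfl⟩ := Finset.mem_image.1 hm
      exact hx (by simp [f, hc i])
    have ha := hnot a hfa
    have hb := hnot b hfb
    have hab : a ≠ b := by
      rintro rfl
      exact absurd hlt (not_lt.2 (mul_self_nonneg _))
    have hP (x : ℝ) : ∏ t ∈ Finset.univ.image z, (x - t) = P x := by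
      rw [Finset.prod_image fun i _ j _ h => hz h]
    have hb' : b ∉ insert a (Finset.univ.image z) := by simp [hab.symm, hb] at hb ⊢
    have hcard : (insert b (insert a (Finset.univ.image z))).card = n + 1 := by
      rw [Finset.card_insert_of_notMem hb', Finset.card_insert_of_notMem ha,
        Finset.card_image_of_injective _ hz, Finset.card_univ, hι]
    have key2 (ε : ℝ) (hε : ε ≠ 0) (h1 : 0 ≤ ε * f a * (a - b)) (h2 : 0 ≤ ε * f b * (b - a)) :
        False := by
      have := expPoly_eq_zero_of_mul_prod_nonneg ν (ε • c) _ hcard fun t ht => by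
        rw [expPoly_smul]
        rcases Finset.mem_insert.1 ht with rfl | ht
        · rw [Finset.erase_insert hb', Finset.prod_insert ha, hP]
          simp only [f] at h2
          linarith
        rcases Finset.mem_insert.1 ht with rfl | ht
        · rw [Finset.erase_insert_of_ne hab.symm, Finset.erase_insert ha, Finset.prod_insert hb, hP]
          simp only [f] at h1
          linarith
        · obtain ⟨i, -, rfl⟩ := Finset.mem_image.1 ht
          simp [hc i]
      exact (smul_ne_zero hε hc0) this
    -- The product of `f a * (a - b)` and `f b * (b - a)` is `-(f a * f b) * (a - b) ^ 2 > 0`, so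
    -- one `ε = ±1` serves both.
    have hab' : 0 < (a - b) ^ 2 := by have := sub_ne_zero.2 hab; positivity
    rcases le_total 0 (f a * (a - b)) with h | h
    · refine key2 1 one_ne_zero (by simpa using h) ?_
      by_contra! h'
      nlinarith [mul_nonneg h (neg_nonneg.2 h'.le), mul_pos (neg_pos.2 hlt) hab',
        mul_pos (neg_pos.2 hlt) (neg_pos.2 h')]
    · refine key2 (-1) (by norm_num) (by linarith) ?_
      by_contra! h'
      nlinarith [mul_nonneg (neg_nonneg.2 h) (neg_nonneg.2 h'.le), mul_pos (neg_pos.2 hlt) hab']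
  have hsign : ∃ ε : ℝ, ε ≠ 0 ∧ ∀ s, 0 ≤ ε * f s := by
    by_cases h : ∃ a, 0 < f a
    · obtain ⟨a, ha⟩ := h
      refine ⟨1, one_ne_zero, fun s => ?_⟩
      by_contra! hs
      exact key a s (mul_neg_of_pos_of_neg ha (by simpa using hs))
    · push Not at h
      exact ⟨-1, by norm_num, fun s => by linarith [h s]⟩
  obtain ⟨ε, hε, hs⟩ := hsign
  have hne : ε • c ≠ 0 := smul_ne_zero hε hc0
  refine ⟨‖ε • c‖⁻¹ • ε • c, ?_, fun i => ?_, fun s => ?_⟩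
  · rw [mem_sphere_zero_iff_norm, norm_smul, norm_inv, norm_norm,
      inv_mul_cancel₀ (norm_ne_zero_iff.2 hne)]
  · rw [expPoly_smul, expPoly_smul, hc, mul_zero, mul_zero]
  · rw [expPoly_smul, expPoly_smul]
    have := mul_nonneg (inv_nonneg.2 (norm_nonneg (ε • c))) (hs s)
    simp only [f, P] at this
    linarith

theorem eventually_injective_add_mul {ι : Type*} [Finite ι] (z e : ι → ℝ)
    (he : Function.Injective e) :
    ∀ᶠ δ in 𝓝[≠] (0 : ℝ), Function.Injective fun i => z i + δ * e i := by
  have : ∀ᶠ δ in 𝓝[≠] (0 : ℝ), ∀ i j, i ≠ j → z i + δ * e i ≠ z j + δ * e j := by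
    refine eventually_all.2 fun i => eventually_all.2 fun j => ?_
    by_cases hij : i = j
    · exact Eventually.of_forall fun _ h => absurd hij h
    by_cases hz : z i = z j
    · filter_upwards [self_mem_nhdsWithin] with δ hδ _ h
      rw [hz] at h
      exact hij (he (mul_left_cancel₀ hδ (add_left_cancel h)))
    · have hc : ContinuousAt (fun δ : ℝ => (z i + δ * e i) - (z j + δ * e j)) 0 := by fun_prop
      have := hc.eventually_ne (y := 0) (by simpa [sub_eq_zero] using hz)
      filter_upwards [this.filter_mono nhdsWithin_le_nhds] with δ hδ _
      exact sub_ne_zero.1 hδ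
  filter_upwards [this] with δ h i j hij
  by_contra hne
  exact h i j hne hij

/-- Given `n - 1` real numbers `z i`, not necessarily distinct, there is an exponential polynomial
of norm one in the `n`-dimensional space that vanishes at all `z i` and changes sign precisely as
the polynomial `∏ i, (s - z i)` does. -/
theorem exists_expPoly_mul_prod_nonneg {n : ℕ} {ι : Type*} [Fintype ι]
    (hι : Fintype.card ι + 1 = n) (ν : ℕ → ℝ) (z : ι → ℝ) :
    ∃ c ∈ Metric.sphere (0 : Fin n → ℝ) 1, (∀ i, expPoly n ν c (z i) = 0) ∧
      ∀ s, 0 ≤ expPoly n ν c s * ∏ i, (s - z i) := by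
  classical
  -- Coinciding zeros are separated by distinct shifts `δ * e i`. As `δ → 0`, compactness of the
  -- unit sphere supplies a nonzero limit.
  let e : ι → ℝ := fun i => ((Fintype.equivFin ι i : ℕ) : ℝ)
  have he : Function.Injective e := fun i j h => by
    simpa [e, Fin.val_inj] using h
  have hev : ∀ᶠ δ in 𝓝[≠] (0 : ℝ), ∃ c ∈ Metric.sphere (0 : Fin n → ℝ) 1,
      (∀ i, expPoly n ν c (z i + δ * e i) = 0) ∧
        ∀ s, 0 ≤ expPoly n ν c s * ∏ i, (s - (z i + δ * e i)) := by
    filter_upwards [eventually_injective_add_mul z e he] with δ hδ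
    exact exists_expPoly_mul_prod_nonneg_of_injective hι ν _ hδ
  obtain ⟨c, hc⟩ := hev.choice
  let 𝒰 := Ultrafilter.of (𝓝[≠] (0 : ℝ))
  have hU : (𝒰 : Filter ℝ) ≤ 𝓝[≠] 0 := Ultrafilter.of_le _
  have hc' : ∀ᶠ δ in (𝒰 : Filter ℝ), _ := hc.filter_mono hU
  obtain ⟨c₀, hc₀, hlim⟩ := (isCompact_sphere (0 : Fin n → ℝ) 1).ultrafilter_le_nhds (𝒰.map c)
    (by rw [le_principal_iff]; exact hc'.mono fun δ h => h.1)
  have hlim : Tendsto c 𝒰 (𝓝 c₀) := hlim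
  have hδ : Tendsto (fun δ : ℝ => δ) 𝒰 (𝓝 0) := hU.trans nhdsWithin_le_nhds
  have hz (i : ι) : Tendsto (fun δ : ℝ => z i + δ * e i) 𝒰 (𝓝 (z i)) := by
    simpa using (hδ.mul_const (e i)).const_add (z i)
  have hF {g : ℝ → ℝ} {x : ℝ} (hg : Tendsto g 𝒰 (𝓝 x)) :
      Tendsto (fun δ => expPoly n ν (c δ) (g δ)) 𝒰 (𝓝 (expPoly n ν c₀ x)) :=
    ((continuous_expPoly n).tendsto (ν, c₀, x)).comp
      (tendsto_const_nhds.prodMk_nhds (hlim.prodMk_nhds hg))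
  refine ⟨c₀, hc₀, fun i => ?_, fun s => ?_⟩
  · refine tendsto_nhds_unique (hF (hz i)) ?_
    exact tendsto_const_nhds.congr' (hc'.mono fun δ h => (h.2.1 i).symm)
  · refine ge_of_tendsto ((hF tendsto_const_nhds).mul
      (tendsto_finsetProd _ fun i _ => (hz i).const_sub s)) (hc'.mono fun δ h => h.2.2 s)

/-! ### Smoothness and double zeros. -/

theorem differentiable_expDivDiff (j : ℕ) (ν : ℕ → ℝ) : Differentiable ℝ (expDivDiff j ν) := by
  cases j with
  | zero => exact fun s => (hasDerivAt_expDivDiff_zero ν s).differentiableAt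
  | succ j => exact fun s => (hasDerivAt_expDivDiff_succ j ν s).differentiableAt

theorem contDiff_expDivDiff (j : ℕ) (ν : ℕ → ℝ) : ContDiff ℝ 1 (expDivDiff j ν) := by
  refine contDiff_one_iff_deriv.2 ⟨differentiable_expDivDiff j ν, ?_⟩
  cases j with
  | zero =>
    rw [funext fun s => (hasDerivAt_expDivDiff_zero ν s).deriv]
    exact (continuous_expDivDiff_right 0 ν).const_mul _
  | succ j =>
    rw [funext fun s => (hasDerivAt_expDivDiff_succ j ν s).deriv]
    exact ((continuous_expDivDiff_right (j + 1) ν).const_mul _).add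
      (continuous_expDivDiff_right j _)

/-- An exponential polynomial from a space of dimension `2 N + 2` with `N + 1` double zeros
vanishes. -/
theorem expPoly_eq_zero_of_double_zeros {N : ℕ} (ν : ℕ → ℝ) (c : Fin (2 * N + 2) → ℝ)
    {s : Fin (N + 1) → ℝ} (hs : StrictMono s) (h0 : ∀ k, expPoly (2 * N + 2) ν c (s k) = 0)
    (h1 : ∀ k, HasDerivAt (expPoly (2 * N + 2) ν c) 0 (s k)) : c = 0 := by
  have htail0 (k) : expPoly (2 * N + 1) (fun k => ν (k + 1)) (Fin.tail c) (s k) = 0 := by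
    have := (h1 k).unique (hasDerivAt_expPoly ν c (s k))
    rw [h0 k] at this
    linarith
  choose ξ hξ hd using fun i : Fin N =>
    exists_mem_Ioo_expPoly_tail ν c (hs (Fin.castSucc_lt_succ (i := i)))
  have hξ0 (i) : expPoly (2 * N + 1) (fun k => ν (k + 1)) (Fin.tail c) (ξ i) = 0 := by
    have := hd i
    rw [h0, h0] at this
    simpa [(Real.exp_pos _).ne'] using this
  have hinj : Function.Injective (Sum.elim s ξ) := by
    refine Function.Injective.sumElim hs.injective ?_ ?_
    -- The `N + 1` nodes and the `N` interlacing Rolle points are `2 N + 1` distinct zeros of the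
    -- tail, as many as its dimension.
    · refine StrictMono.injective (f := ξ) fun i j hij => ?_
      exact ((hξ i).2.trans_le (hs.monotone (by
        rw [Fin.le_iff_val_le_val]; simpa using hij))).trans (hξ j).1
    · intro k i hki
      rcases le_or_gt k i.castSucc with h | h
      · exact absurd hki ((hs.monotone h).trans_lt (hξ i).1).ne
      · have : i.succ ≤ k := by rwa [Fin.le_iff_val_le_val, Fin.val_succ, Nat.succ_le_iff]
        exact absurd hki ((hξ i).2.trans_le (hs.monotone this)).ne'
  have htail : Fin.tail c = 0 := by
    refine expPoly_eq_zero_of_zeros (fun k => ν (k + 1)) (Fin.tail c)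
      (Finset.univ.image (Sum.elim s ξ)) ?_ ?_
    · rw [Finset.card_image_of_injective _ hinj]
      simp only [Finset.card_univ, Fintype.card_sum, Fintype.card_fin]
      omega
    · intro t ht
      obtain ⟨k | i, -, rfl⟩ := Finset.mem_image.1 ht
      · exact htail0 k
      · exact hξ0 i
  refine eq_zero_of_tail_eq_zero c htail ?_
  have := h0 0
  rw [expPoly_of_tail_eq_zero ν c htail] at this
  exact (mul_eq_zero.1 this).resolve_right (Real.exp_pos _).ne'

/-! ### The moment map: uniqueness and openness. -/

/-- The values at the basis functions of the functional with nodes `p.1` and weights `p.2`. -/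
def quadMoments (N : ℕ) (ν : ℕ → ℝ) (p : (Fin (N + 1) → ℝ) × (Fin (N + 1) → ℝ)) :
    Fin (2 * N + 2) → ℝ :=
  fun j => ∑ k, p.2 k * expDivDiff j ν (p.1 k)

/-- Increasing negative nodes with positive weights. -/
def quadDomain (N : ℕ) : Set ((Fin (N + 1) → ℝ) × (Fin (N + 1) → ℝ)) :=
  {p | StrictMono p.1 ∧ (∀ k, p.1 k < 0) ∧ ∀ k, 0 < p.2 k}

/-- The vector `y` of moments is positive on the nonzero exponential polynomials that are
nonnegative on the negative half line. -/
def IsPositiveMoments (n : ℕ) (ν : ℕ → ℝ) (y : Fin n → ℝ) : Prop :=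
  ∀ c : Fin n → ℝ, c ≠ 0 → (∀ s ≤ 0, 0 ≤ expPoly n ν c s) → 0 < ∑ j, c j * y j

theorem sum_mul_quadMoments {N : ℕ} (ν : ℕ → ℝ) (p : (Fin (N + 1) → ℝ) × (Fin (N + 1) → ℝ))
    (c : Fin (2 * N + 2) → ℝ) :
    ∑ j, c j * quadMoments N ν p j = ∑ k, p.2 k * expPoly (2 * N + 2) ν c (p.1 k) := by
  simp only [quadMoments, expPoly, Finset.mul_sum]
  rw [Finset.sum_comm]
  exact Finset.sum_congr rfl fun k _ => Finset.sum_congr rfl fun j _ => by ring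

theorem continuous_quadMoments (N : ℕ) :
    Continuous fun q : (ℕ → ℝ) × ((Fin (N + 1) → ℝ) × (Fin (N + 1) → ℝ)) =>
      quadMoments N q.1 q.2 := by
  unfold quadMoments
  refine continuous_pi fun j => continuous_finsetSum _ fun k _ => Continuous.mul (by fun_prop) ?_
  exact (continuous_expDivDiff j).comp
    (f := fun q : (ℕ → ℝ) × ((Fin (N + 1) → ℝ) × (Fin (N + 1) → ℝ)) => (q.1, q.2.1 k))
    (by fun_prop)

theorem isOpen_quadDomain (N : ℕ) : IsOpen (quadDomain N) := by
  have : quadDomain N = {p | (∀ i j, i < j → p.1 i < p.1 j) ∧ (∀ k, p.1 k < 0) ∧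
      ∀ k, 0 < p.2 k} := rfl
  rw [this]
  simp only [Set.ofPred_and, Set.ofPred_forall]
  refine IsOpen.inter ?_ (IsOpen.inter ?_ ?_)
  · refine isOpen_iInter_of_finite fun i => isOpen_iInter_of_finite fun j =>
      isOpen_iInter_of_finite fun _ => isOpen_lt (by fun_prop) (by fun_prop)
  · exact isOpen_iInter_of_finite fun k => isOpen_lt (by fun_prop) (by fun_prop)
  · exact isOpen_iInter_of_finite fun k => isOpen_lt (by fun_prop) (by fun_prop)

/-- Pad `T` to `n` points and kill the `n - 1` points other than `t`; a further zero at `t` would be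
one too many. -/
theorem exists_expPoly_ne_zero {n : ℕ} (ν : ℕ → ℝ) (T : Finset ℝ) (hT : T.card ≤ n) {t : ℝ}
    (ht : t ∈ T) : ∃ c : Fin n → ℝ, expPoly n ν c t ≠ 0 ∧ ∀ z ∈ T, z ≠ t → expPoly n ν c z = 0 := by
  obtain ⟨T', hTT', hcard⟩ := Infinite.exists_superset_card_eq T n hT
  have hn : 0 < n := hcard ▸ Finset.card_pos.2 ⟨t, hTT' ht⟩
  obtain ⟨c, hc, h0⟩ := exists_expPoly_zeros (n := n) (ι := {x // x ∈ T'.erase t})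
    (by rw [Fintype.card_coe, Finset.card_erase_of_mem (hTT' ht)]; omega) ν Subtype.val
  refine ⟨c, fun h => hc (expPoly_eq_zero_of_zeros ν c T' hcard.ge fun z hz => ?_), fun z hz hne =>
    h0 ⟨z, Finset.mem_erase.2 ⟨hne, hTT' hz⟩⟩⟩
  by_cases hzt : z = t
  · rwa [hzt]
  · exact h0 ⟨z, Finset.mem_erase.2 ⟨hzt, hz⟩⟩

/-- A rule with positive weights is determined by its moments. -/
theorem injOn_quadMoments (N : ℕ) (ν : ℕ → ℝ) : Set.InjOn (quadMoments N ν) (quadDomain N) := by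
  classical
  -- Two rules have together at most `2 N + 2` nodes, the dimension of the space, so any single node
  -- can be isolated.
  have hcard (p q : (Fin (N + 1) → ℝ) × (Fin (N + 1) → ℝ)) :
      (Finset.univ.image p.1 ∪ Finset.univ.image q.1).card ≤ 2 * N + 2 := by
    refine (Finset.card_union_le _ _).trans ?_
    have h1 := Finset.card_image_le (s := Finset.univ) (f := p.1)
    have h2 := Finset.card_image_le (s := Finset.univ) (f := q.1)
    simp only [Finset.card_univ, Fintype.card_fin] at h1 h2
    omega
  have hiso (p q : (Fin (N + 1) → ℝ) × (Fin (N + 1) → ℝ)) (k : Fin (N + 1)) :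
      ∃ c : Fin (2 * N + 2) → ℝ, expPoly _ ν c (p.1 k) ≠ 0 ∧
        (∀ i, p.1 i ≠ p.1 k → expPoly _ ν c (p.1 i) = 0) ∧
        ∀ i, q.1 i ≠ p.1 k → expPoly _ ν c (q.1 i) = 0 := by
    obtain ⟨c, h1, h2⟩ := exists_expPoly_ne_zero ν _ (hcard p q) (t := p.1 k) (by simp)
    exact ⟨c, h1, fun i hi => h2 _ (by simp) hi, fun i hi => h2 _ (by simp) hi⟩
  have hsum {p : (Fin (N + 1) → ℝ) × (Fin (N + 1) → ℝ)} (hp : p ∈ quadDomain N) (k : Fin (N + 1))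
      {c : Fin (2 * N + 2) → ℝ} {t : ℝ} (ht : p.1 k = t)
      (h : ∀ i, p.1 i ≠ t → expPoly _ ν c (p.1 i) = 0) :
      ∑ j, c j * quadMoments N ν p j = p.2 k * expPoly _ ν c t := by
    subst ht
    rw [sum_mul_quadMoments, Finset.sum_eq_single k]
    · intro i _ hi
      rw [h i (hp.1.injective.ne hi), mul_zero]
    · simp
  have hsub {p q : (Fin (N + 1) → ℝ) × (Fin (N + 1) → ℝ)} (hp : p ∈ quadDomain N)
      (h : quadMoments N ν p = quadMoments N ν q) : Set.range p.1 ⊆ Set.range q.1 := by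
    rintro _ ⟨k, rfl⟩
    by_contra hk
    obtain ⟨c, h0, h1, h2⟩ := hiso p q k
    have e1 := hsum hp k rfl h1
    rw [h, sum_mul_quadMoments, Finset.sum_eq_zero fun i _ => by
      rw [h2 i fun hi => hk ⟨i, hi⟩, mul_zero]] at e1
    exact mul_ne_zero (hp.2.2 k).ne' h0 e1.symm
  intro p hp q hq h
  have h1 : p.1 = q.1 := (StrictMono.range_inj hp.1 hq.1).1
    ((hsub hp h).antisymm (hsub hq h.symm))
  refine Prod.ext h1 (funext fun k => ?_)
  obtain ⟨c, h0, h2, h3⟩ := hiso p q k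
  have e1 := hsum hp k rfl h2
  rw [h, hsum hq k (congrFun h1 k).symm h3] at e1
  exact (mul_right_cancel₀ h0 e1).symm

/-- The moment map is open at rules with positive weights. -/
theorem map_nhds_quadMoments {N : ℕ} (ν : ℕ → ℝ) {p : (Fin (N + 1) → ℝ) × (Fin (N + 1) → ℝ)}
    (hp : p ∈ quadDomain N) :
    Filter.map (quadMoments N ν) (𝓝 p) = 𝓝 (quadMoments N ν p) := by
  let E := (Fin (N + 1) → ℝ) × (Fin (N + 1) → ℝ)
  let pr1 (k : Fin (N + 1)) : E →L[ℝ] ℝ :=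
    (ContinuousLinearMap.proj k).comp (ContinuousLinearMap.fst ℝ _ _)
  let pr2 (k : Fin (N + 1)) : E →L[ℝ] ℝ :=
    (ContinuousLinearMap.proj k).comp (ContinuousLinearMap.snd ℝ _ _)
  let D (j : Fin (2 * N + 2)) : E →L[ℝ] ℝ := ∑ k, (p.2 k • (deriv (expDivDiff j ν) (p.1 k) • pr1 k)
    + expDivDiff j ν (p.1 k) • pr2 k)
  have hD : HasStrictFDerivAt (quadMoments N ν) (ContinuousLinearMap.pi D) p := by
    refine hasStrictFDerivAt_pi.2 fun j => ?_
    refine HasStrictFDerivAt.fun_sum fun k _ => ?_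
    have h1 : HasStrictDerivAt (expDivDiff j ν) (deriv (expDivDiff j ν) (p.1 k)) (pr1 k p) :=
      ((contDiff_expDivDiff j ν).contDiffAt).hasStrictDerivAt one_ne_zero
    exact (pr2 k).hasStrictFDerivAt.mul (h1.comp_hasStrictFDerivAt p (pr1 k).hasStrictFDerivAt)
  refine hD.map_nhds_eq_of_surj ?_
  -- Otherwise some functional `c ≠ 0` kills the range of the derivative. Varying weights makes the
  -- exponential polynomial of `c` vanish at the nodes; varying nodes, with nonzero weights, makes
  -- these zeros double.
  by_contra hne
  obtain ⟨φ, hφ, hker⟩ := Submodule.exists_le_ker_of_lt_top _ (lt_top_iff_ne_top.2 hne)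
  let c : Fin (2 * N + 2) → ℝ := fun j => φ (Pi.single j 1)
  have hφc (y : Fin (2 * N + 2) → ℝ) : φ y = ∑ j, c j * y j := by
    rw [LinearMap.pi_apply_eq_sum_univ φ y]
    refine Finset.sum_congr rfl fun j _ => ?_
    rw [smul_eq_mul, mul_comm]
    congr 2
    ext i
    simp [Pi.single_apply, eq_comm]
  have hDw (j) (w : E) : D j w = ∑ k, (p.2 k * (deriv (expDivDiff j ν) (p.1 k) * w.1 k) +
      expDivDiff j ν (p.1 k) * w.2 k) := by
    simp only [D, sum_apply]
    rfl
  have hz (w : E) : ∑ j, c j * D j w = 0 := by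
    rw [← hφc (fun j => D j w)]
    exact hker ⟨w, rfl⟩
  have h0 (k) : expPoly _ ν c (p.1 k) = 0 := by
    have := hz (0, Pi.single k 1)
    simpa [hDw, Pi.single_apply, expPoly] using this
  have h1 (k) : HasDerivAt (expPoly _ ν c) 0 (p.1 k) := by
    have := hz (Pi.single k 1, 0)
    have h2 : ∑ j : Fin (2 * N + 2), c j * deriv (expDivDiff j ν) (p.1 k) = 0 := by
      have h3 : p.2 k * ∑ j : Fin (2 * N + 2), c j * deriv (expDivDiff j ν) (p.1 k) = 0 := by
        rw [← this, Finset.mul_sum]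
        refine Finset.sum_congr rfl fun j _ => ?_
        simp only [hDw, Pi.single_apply, Pi.zero_apply, mul_ite, mul_one, mul_zero, add_zero,
          Finset.sum_ite_eq', Finset.mem_univ, if_true]
        ring
      exact (mul_eq_zero.1 h3).resolve_left (hp.2.2 k).ne'
    rw [← h2]
    exact HasDerivAt.fun_sum fun j _ =>
      ((differentiable_expDivDiff j ν).differentiableAt.hasDerivAt).const_mul (c j)
  have hc := expPoly_eq_zero_of_double_zeros ν c hp.1 h0 h1
  exact hφ (LinearMap.ext fun y => by rw [hφc, hc]; simp)

/-! ### Nondegeneration of rules and compactness. -/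

/-- Prescribe a simple zero at `s j` and double zeros at the other nodes, `2 N + 1` in all. This is
the test function against `s j` escaping to `-∞`. -/
theorem exists_expPoly_mul_sub_nonneg {N : ℕ} (ν : ℕ → ℝ) (s : Fin (N + 1) → ℝ)
    (j : Fin (N + 1)) : ∃ c ∈ Metric.sphere (0 : Fin (2 * N + 2) → ℝ) 1,
      (∀ k, expPoly _ ν c (s k) = 0) ∧ ∀ x, 0 ≤ expPoly _ ν c x * (x - s j) := by
  obtain ⟨c, hc, h0, h1⟩ := exists_expPoly_mul_prod_nonneg (n := 2 * N + 2)
    (ι := Fin (N + 1) ⊕ Fin N) (by simp; omega) ν (Sum.elim s (s ∘ j.succAbove))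
  refine ⟨c, hc, fun k => h0 (Sum.inl k), fun x => ?_⟩
  have h2 := h1 x
  simp only [Fintype.prod_sum_type, Sum.elim_inl, Sum.elim_inr, Function.comp_apply] at h2
  rw [Fin.prod_univ_succAbove _ j] at h2
  by_cases hA : ∏ i, (x - s (j.succAbove i)) = 0
  · obtain ⟨i, -, hi⟩ := Finset.prod_eq_zero_iff.1 hA
    have : expPoly _ ν c (s (j.succAbove i)) = 0 := h0 (Sum.inl _)
    rw [sub_eq_zero.1 hi, this, zero_mul]
  · refine nonneg_of_mul_nonneg_left (b := (∏ i, (x - s (j.succAbove i))) ^ 2) ?_ (by positivity)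
    calc _ ≤ _ := h2
      _ = _ := by ring

/-- Prescribe a simple zero at `0` and double zeros at the nodes other than `s j`. This is the test
function against a vanishing weight, a node reaching `0` and colliding nodes. -/
theorem exists_expPoly_nonneg {N : ℕ} (ν : ℕ → ℝ) (s : Fin (N + 1) → ℝ)
    (j : Fin (N + 1)) : ∃ c ∈ Metric.sphere (0 : Fin (2 * N + 2) → ℝ) 1,
      (∀ k, k ≠ j → expPoly _ ν c (s k) = 0) ∧ expPoly _ ν c 0 = 0 ∧
        ∀ x ≤ 0, 0 ≤ expPoly _ ν c x := by
  obtain ⟨c, hc, h0, h1⟩ := exists_expPoly_mul_prod_nonneg (n := 2 * N + 2)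
    (ι := Unit ⊕ (Fin N ⊕ Fin N)) (by simp; omega) ν
    (Sum.elim (fun _ => 0) (Sum.elim (s ∘ j.succAbove) (s ∘ j.succAbove)))
  have hz : expPoly _ ν c 0 = 0 := h0 (Sum.inl ())
  have hneg (x) : expPoly _ ν (-c) x = - expPoly _ ν c x := by
    rw [← neg_one_smul ℝ c, expPoly_smul]; ring
  refine ⟨-c, by simpa using hc, fun k hk => ?_, by rw [hneg, hz, neg_zero], fun x hx => ?_⟩
  · obtain ⟨i, rfl⟩ := Fin.exists_succAbove_eq hk
    rw [hneg, neg_eq_zero]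
    exact h0 (Sum.inr (Sum.inl i))
  rw [hneg]
  rcases hx.eq_or_lt with rfl | hx
  · rw [hz, neg_zero]
  have h2 := h1 x
  simp only [Fintype.prod_sum_type, Sum.elim_inl, Sum.elim_inr, Function.comp_apply,
    Finset.univ_unique, Finset.prod_const, Finset.card_singleton, pow_one, sub_zero] at h2
  by_cases hA : ∏ i, (x - s (j.succAbove i)) = 0
  · obtain ⟨i, -, hi⟩ := Finset.prod_eq_zero_iff.1 hA
    rw [sub_eq_zero.1 hi]
    have : expPoly _ ν c (s (j.succAbove i)) = 0 := h0 (Sum.inr (Sum.inl i))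
    rw [this, neg_zero]
  · have hx' := neg_pos.2 hx
    refine nonneg_of_mul_nonneg_left (b := -x * (∏ i, (x - s (j.succAbove i))) ^ 2) ?_
      (by positivity)
    calc _ ≤ _ := h2
      _ = _ := by ring

theorem exists_tendsto_of_eventually_mem_Icc {I : Type*} {𝒰 : Ultrafilter I} {f : I → ℝ} {a b : ℝ}
    (h : ∀ᶠ i in (𝒰 : Filter I), f i ∈ Set.Icc a b) :
    ∃ x ∈ Set.Icc a b, Tendsto f 𝒰 (𝓝 x) :=
  isCompact_Icc.ultrafilter_le_nhds (𝒰.map f) (le_principal_iff.2 h)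

theorem exists_tendsto_of_mem_sphere {I : Type*} {𝒰 : Ultrafilter I} {n : ℕ} {c : I → Fin n → ℝ}
    (h : ∀ i, c i ∈ Metric.sphere (0 : Fin n → ℝ) 1) :
    ∃ c₀, c₀ ≠ 0 ∧ Tendsto c 𝒰 (𝓝 c₀) := by
  obtain ⟨c₀, hc₀, hlim⟩ := (isCompact_sphere (0 : Fin n → ℝ) 1).ultrafilter_le_nhds (𝒰.map c)
    (le_principal_iff.2 (show ∀ᶠ i in (𝒰 : Filter I), _ from Eventually.of_forall h))
  exact ⟨c₀, ne_zero_of_mem_unit_sphere ⟨c₀, hc₀⟩, hlim⟩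

theorem Filter.Tendsto.expPoly {I : Type*} {l : Filter I} {n : ℕ} {ν : I → ℕ → ℝ} {ν₀ : ℕ → ℝ}
    {c : I → Fin n → ℝ} {c₀ : Fin n → ℝ} {s : I → ℝ} {s₀ : ℝ} (hν : Tendsto ν l (𝓝 ν₀))
    (hc : Tendsto c l (𝓝 c₀)) (hs : Tendsto s l (𝓝 s₀)) :
    Tendsto (fun i => _root_.expPoly n (ν i) (c i) (s i)) l (𝓝 (_root_.expPoly n ν₀ c₀ s₀)) :=
  ((continuous_expPoly n).tendsto (ν₀, c₀, s₀)).comp (hν.prodMk_nhds (hc.prodMk_nhds hs))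

/-- Rules whose moments converge to positive moments converge, and do not degenerate. -/
theorem exists_tendsto_of_tendsto_quadMoments {I : Type*} {𝒰 : Ultrafilter I} {N : ℕ}
    {ν : I → ℕ → ℝ} {ν₀ : ℕ → ℝ} (hν : Tendsto ν 𝒰 (𝓝 ν₀))
    {p : I → (Fin (N + 1) → ℝ) × (Fin (N + 1) → ℝ)} (hp : ∀ᶠ i in (𝒰 : Filter I), p i ∈ quadDomain N)
    {y : Fin (2 * N + 2) → ℝ} (hy : Tendsto (fun i => quadMoments N (ν i) (p i)) 𝒰 (𝓝 y))
    (hpos : IsPositiveMoments (2 * N + 2) ν₀ y) :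
    ∃ p₀ ∈ quadDomain N, Tendsto p 𝒰 (𝓝 p₀) := by
  have hcy {c : I → Fin (2 * N + 2) → ℝ} {c₀} (hc : Tendsto c 𝒰 (𝓝 c₀)) :
      Tendsto (fun i => ∑ k, (p i).2 k * expPoly (2 * N + 2) (ν i) (c i) ((p i).1 k)) 𝒰
        (𝓝 (∑ j, c₀ j * y j)) := by
    simp only [← sum_mul_quadMoments]
    exact tendsto_finsetSum _ fun j _ => (tendsto_pi_nhds.1 hc j).mul (tendsto_pi_nhds.1 hy j)
  have hbot (j : Fin (N + 1)) : ¬ Tendsto (fun i => (p i).1 j) 𝒰 atBot := by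
    intro hj
    choose c hc h0 h1 using fun i => exists_expPoly_mul_sub_nonneg (ν i) (p i).1 j
    obtain ⟨c₀, hc₀, hlim⟩ := exists_tendsto_of_mem_sphere (𝒰 := 𝒰) hc
    have h2 : ∑ j, c₀ j * y j = 0 := by
      refine tendsto_nhds_unique (hcy hlim) ?_
      simp [h0]
    -- As `s j → -∞`, every fixed `s` ends up to the right of it, so the limit is nonnegative
    -- although its moment is zero.
    refine (hpos c₀ hc₀ fun s _ => ?_).ne' h2
    refine ge_of_tendsto (hν.expPoly hlim (tendsto_const_nhds (x := s))) ?_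
    filter_upwards [hj.eventually_lt_atBot s] with i hi
    exact nonneg_of_mul_nonneg_left (h1 i s) (sub_pos.2 hi)
  have hs (j : Fin (N + 1)) : ∃ x ≤ 0, Tendsto (fun i => (p i).1 j) 𝒰 (𝓝 x) := by
    have := hbot j
    rw [tendsto_atBot] at this
    push Not at this
    obtain ⟨M, hM⟩ := this
    obtain ⟨x, hx, h⟩ := exists_tendsto_of_eventually_mem_Icc (𝒰 := 𝒰) (a := M) (b := 0)
      (f := fun i => (p i).1 j) (by
        filter_upwards [hM, hp] with i hi hi'
        exact ⟨hi.le, (hi'.2.1 j).le⟩)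
    exact ⟨x, hx.2, h⟩
  choose s hs0 hs using hs
  have hv (j : Fin (N + 1)) : ∃ x, 0 ≤ x ∧ Tendsto (fun i => (p i).2 j) 𝒰 (𝓝 x) := by
    -- The first basis function is a positive exponential, so its moment bounds each weight
    -- separately.
    have hlim : Tendsto (fun i => quadMoments N (ν i) (p i) 0 * Real.exp (-(ν i 0 * (p i).1 j))) 𝒰
        (𝓝 (y 0 * Real.exp (-(ν₀ 0 * s j)))) :=
      (tendsto_pi_nhds.1 hy 0).mul
        (Real.continuous_exp.tendsto _ |>.comp ((tendsto_pi_nhds.1 hν 0).mul (hs j)).neg)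
    obtain ⟨x, hx, h⟩ := exists_tendsto_of_eventually_mem_Icc (𝒰 := 𝒰) (a := 0)
      (b := y 0 * Real.exp (-(ν₀ 0 * s j)) + 1) (f := fun i => (p i).2 j) (by
        filter_upwards [hp, hlim.eventually_lt_const (lt_add_one _)] with i hi hi'
        refine ⟨(hi.2.2 j).le, le_trans ?_ hi'.le⟩
        rw [Real.exp_neg, ← div_eq_mul_inv, le_div_iff₀ (Real.exp_pos _)]
        exact Finset.single_le_sum (f := fun k => (p i).2 k * Real.exp (ν i 0 * (p i).1 k))
          (fun k _ => mul_nonneg (hi.2.2 k).le (Real.exp_pos _).le) (Finset.mem_univ j))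
    exact ⟨x, hx.1, h⟩
  choose v hv0 hv using hv
  have hkey (j : Fin (N + 1)) : 0 < v j ∧ s j < 0 ∧ ∀ k, k ≠ j → s k ≠ s j := by
    choose c hc h0 h1 h2 using fun i => exists_expPoly_nonneg (ν i) (p i).1 j
    obtain ⟨c₀, hc₀, hlim⟩ := exists_tendsto_of_mem_sphere (𝒰 := 𝒰) hc
    have hz : expPoly _ ν₀ c₀ 0 = 0 :=
      tendsto_nhds_unique (hν.expPoly hlim (tendsto_const_nhds (x := 0))) (by simp [h1])
    have hk (k) (hkj : k ≠ j) : expPoly _ ν₀ c₀ (s k) = 0 :=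
      tendsto_nhds_unique (hν.expPoly hlim (hs k)) (by simp [h0 _ k hkj])
    have hpos' := hpos c₀ hc₀ fun x hx =>
      ge_of_tendsto' (hν.expPoly hlim (tendsto_const_nhds (x := x))) fun i => h2 i x hx
    -- Only node `j` contributes, so the positive limit moment is `v j` times the value at `s j`;
    -- each degeneration would make it zero.
    have heq : ∑ j, c₀ j * y j = v j * expPoly _ ν₀ c₀ (s j) := by
      refine tendsto_nhds_unique (hcy hlim) (((hv j).mul (hν.expPoly hlim (hs j))).congr fun i => ?_)
      rw [Finset.sum_eq_single j (fun k _ hkj => by rw [h0 i k hkj, mul_zero]) (by simp)]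
    rw [heq] at hpos'
    refine ⟨(hv0 j).lt_of_ne' fun h => ?_, (hs0 j).lt_of_ne fun h => ?_, fun k hkj h => ?_⟩
    · simp [h] at hpos'
    · simp [h, hz] at hpos'
    · simp [← h, hk k hkj] at hpos'
  refine ⟨(s, v), ⟨?_, fun j => (hkey j).2.1, fun j => (hkey j).1⟩,
    (tendsto_pi_nhds.2 hs).prodMk_nhds (tendsto_pi_nhds.2 hv)⟩
  refine Monotone.strictMono_of_injective (fun i j hij => ?_) fun i j hij => ?_
  · refine le_of_tendsto_of_tendsto (hs i) (hs j) ?_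
    filter_upwards [hp] with a ha
    exact ha.1.monotone hij
  · by_contra hne
    exact (hkey j).2.2 i hne hij

/-! ### Existence by continuation. -/

/-- Positive moments are the moments of a rule. -/
theorem exists_quadMoments_eq {N : ℕ} {ν : ℕ → ℝ} {y : Fin (2 * N + 2) → ℝ}
    (hy : IsPositiveMoments (2 * N + 2) ν y) : ∃ p ∈ quadDomain N, quadMoments N ν p = y := by
  -- An arbitrary starting rule: nodes `-(N + 1), …, -1` and unit weights.
  let p₁ : (Fin (N + 1) → ℝ) × (Fin (N + 1) → ℝ) := (fun k => (k : ℕ) - (N + 1 : ℝ), fun _ => 1)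
  have hp₁ : p₁ ∈ quadDomain N := by
    refine ⟨fun i j hij => ?_, fun k => ?_, fun k => one_pos⟩
    · have : ((i : ℕ) : ℝ) < (j : ℕ) := by exact_mod_cast hij
      simpa [p₁] using this
    · have : ((k : ℕ) : ℝ) < N + 1 := by exact_mod_cast k.2
      simpa [p₁] using this
  let path : ℝ → Fin (2 * N + 2) → ℝ := fun τ => (1 - τ) • quadMoments N ν p₁ + τ • y
  have hpath : Continuous path := by fun_prop
  let A : Set ℝ := {τ | ∃ p ∈ quadDomain N, quadMoments N ν p = path τ}
  have h0 : (0 : ℝ) ∈ A := ⟨p₁, hp₁, by simp [path]⟩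
  have hpos (τ : ℝ) (hτ : 0 < τ) (hτ1 : τ ≤ 1) : IsPositiveMoments (2 * N + 2) ν (path τ) := by
    intro c hc hF
    have h1 : 0 ≤ ∑ j, c j * quadMoments N ν p₁ j := by
      rw [sum_mul_quadMoments]
      exact Finset.sum_nonneg fun k _ => mul_nonneg (hp₁.2.2 k).le (hF _ (hp₁.2.1 k).le)
    have h2 := mul_pos hτ (hy c hc hF)
    have h3 := mul_nonneg (sub_nonneg.2 hτ1) h1
    have : ∑ j, c j * path τ j =
        (1 - τ) * ∑ j, c j * quadMoments N ν p₁ j + τ * ∑ j, c j * y j := by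
      simp only [path, Pi.add_apply, Pi.smul_apply, smul_eq_mul, Finset.mul_sum,
        ← Finset.sum_add_distrib]
      exact Finset.sum_congr rfl fun j _ => by ring
    rw [this]
    linarith
  have hclosed : IsClosed (A ∩ Set.Icc 0 1) := by
    refine isClosed_iff_ultrafilter.2 fun τ 𝒰 hU hA => ?_
    have hτ : τ ∈ Set.Icc (0 : ℝ) 1 :=
      isClosed_iff_ultrafilter.1 isClosed_Icc τ 𝒰 hU (mem_of_superset hA Set.inter_subset_right)
    rcases hτ.1.eq_or_lt with rfl | hτ0
    · exact ⟨h0, hτ⟩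
    have hA' : ∀ᶠ t in (𝒰 : Filter ℝ), ∃ p ∈ quadDomain N, quadMoments N ν p = path t :=
      mem_of_superset hA Set.inter_subset_left
    obtain ⟨p, hp⟩ := hA'.choice
    have hlim : Tendsto (fun t => quadMoments N ν (p t)) 𝒰 (𝓝 (path τ)) :=
      Tendsto.congr' (hp.mono fun t h => h.2.symm) ((hpath.tendsto τ).mono_left hU)
    obtain ⟨p₀, hp₀, hlim₀⟩ := exists_tendsto_of_tendsto_quadMoments (ν := fun _ => ν)
      tendsto_const_nhds (hp.mono fun t h => h.1) hlim (hpos τ hτ0 hτ.2)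
    refine ⟨⟨p₀, hp₀, tendsto_nhds_unique ?_ hlim⟩, hτ⟩
    exact ((continuous_quadMoments N).tendsto (ν, p₀)).comp (tendsto_const_nhds.prodMk_nhds hlim₀)
  -- The attained parameters form a closed set by nondegeneration; openness of the moment map lets
  -- each be exceeded.
  have hsub := hclosed.Icc_subset_of_forall_exists_gt h0 fun τ hτ b hb => by
    obtain ⟨p, hp, hpτ⟩ := hτ.1
    have hnhds : quadMoments N ν '' quadDomain N ∈ 𝓝 (path τ) := by
      rw [← hpτ, ← map_nhds_quadMoments ν hp]
      exact image_mem_map ((isOpen_quadDomain N).mem_nhds hp)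
    have hev : ∀ᶠ t in 𝓝[>] τ, t ∈ A :=
      (hpath.continuousAt.eventually hnhds).filter_mono nhdsWithin_le_nhds
    exact (hev.and (Ioc_mem_nhdsGT hb)).exists
  obtain ⟨p, hp, h⟩ := hsub (Set.right_mem_Icc.2 zero_le_one)
  exact ⟨p, hp, by simpa [path] using h⟩

/-! ### From contour integrals to divided differences. -/

theorem hasDerivAt_circleIntegral_mul_exp {R : ℝ} (hR : 0 ≤ R) {h : ℂ → ℂ}
    (hh : ContinuousOn h (Metric.sphere 0 R)) (s : ℝ) :
    HasDerivAt (fun s : ℝ => ∮ t in C(0, R), h t * Complex.exp (t * s))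
      (∮ t in C(0, R), t * (h t * Complex.exp (t * s))) s := by
  have hcm : Continuous fun θ : ℝ => h (circleMap 0 R θ) :=
    hh.comp_continuous (continuous_circleMap 0 R) fun θ => circleMap_mem_sphere 0 hR θ
  have hcirc := continuous_circleMap (0 : ℂ) R
  have hc1 (s : ℝ) : Continuous fun θ : ℝ => deriv (circleMap 0 R) θ •
      (h (circleMap 0 R θ) * Complex.exp (circleMap 0 R θ * s)) := by
    simp only [deriv_circleMap]
    exact (hcirc.mul continuous_const).smul (hcm.mul (by fun_prop))
  have hc2 (s : ℝ) : Continuous fun θ : ℝ => deriv (circleMap 0 R) θ •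
      (circleMap 0 R θ * (h (circleMap 0 R θ) * Complex.exp (circleMap 0 R θ * s))) := by
    simp only [deriv_circleMap]
    exact (hcirc.mul continuous_const).smul (hcirc.mul (hcm.mul (by fun_prop)))
  have hcb : Continuous fun θ : ℝ => R * (R * (‖h (circleMap 0 R θ)‖ * Real.exp (R * (|s| + 1)))) := by
    have := hcm.norm
    fun_prop
  refine (intervalIntegral.hasDerivAt_integral_of_dominated_loc_of_deriv_le (𝕜 := ℝ)
    (F' := fun s θ => deriv (circleMap 0 R) θ •
      (circleMap 0 R θ * (h (circleMap 0 R θ) * Complex.exp (circleMap 0 R θ * s))))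
    (s := Metric.ball s 1) (Metric.ball_mem_nhds s one_pos)
    (Eventually.of_forall fun s => (hc1 s).aestronglyMeasurable) ((hc1 s).intervalIntegrable _ _)
    (hc2 s).aestronglyMeasurable (Eventually.of_forall fun θ _ x hx => ?_)
    (hcb.intervalIntegrable _ _) (Eventually.of_forall fun θ _ x _ => ?_)).2
  · have hn : ‖circleMap 0 R θ‖ = R := by simp [abs_of_nonneg hR]
    have hx' : |x| ≤ |s| + 1 := by
      have h1 : |x - s| < 1 := by simpa [Real.dist_eq] using hx
      have h2 := abs_sub_abs_le_abs_sub x s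
      linarith
    have he : ‖Complex.exp (circleMap 0 R θ * x)‖ ≤ Real.exp (R * (|s| + 1)) := by
      rw [Complex.norm_exp]
      refine Real.exp_le_exp.2 ((Complex.re_le_norm _).trans ?_)
      rw [norm_mul, hn, Complex.norm_real, Real.norm_eq_abs]
      exact mul_le_mul_of_nonneg_left hx' hR
    rw [norm_smul, norm_mul, norm_mul, hn, deriv_circleMap, norm_mul, hn, Complex.norm_I, mul_one]
    gcongr
  · refine HasDerivAt.const_mul (deriv (circleMap 0 R) θ) ?_
    have h1 : HasDerivAt (fun x : ℝ => circleMap 0 R θ * (x : ℂ)) (circleMap 0 R θ) x := by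
      simpa using (hasDerivAt_id x).ofReal_comp.const_mul (circleMap 0 R θ)
    exact (h1.cexp.const_mul (h (circleMap 0 R θ))).congr_deriv (by ring)

/-- Variation of constants in the basis of divided differences. -/
theorem eq_sum_expDivDiff_of_hasDerivAt {n : ℕ} {ν : ℕ → ℝ} {f : ℝ → ℂ} {c : ℕ → ℂ}
    (hf : ∀ s, HasDerivAt f (ν 0 * f s + ∑ j ∈ Finset.range n,
      c j * (expDivDiff j (fun k => ν (k + 1)) s : ℂ)) s) (s : ℝ) :
    f s = f 0 * (expDivDiff 0 ν s : ℂ) +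
      ∑ j ∈ Finset.range n, c j * (expDivDiff (j + 1) ν s : ℂ) := by
  set g : ℝ → ℂ := fun s => f 0 * (expDivDiff 0 ν s : ℂ) +
      ∑ j ∈ Finset.range n, c j * (expDivDiff (j + 1) ν s : ℂ) with hg
  have hgd (s) : HasDerivAt g (ν 0 * g s + ∑ j ∈ Finset.range n,
      c j * (expDivDiff j (fun k => ν (k + 1)) s : ℂ)) s := by
    have h1 := ((hasDerivAt_expDivDiff_zero ν s).ofReal_comp.const_mul (f 0)).add
      (HasDerivAt.fun_sum (u := Finset.range n) fun j _ =>
        (hasDerivAt_expDivDiff_succ j ν s).ofReal_comp.const_mul (c j))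
    refine h1.congr_deriv ?_
    simp only [hg, Complex.ofReal_mul, Complex.ofReal_add, mul_add, Finset.sum_add_distrib,
      Finset.mul_sum]
    rw [← add_assoc]
    congr 2
    · ring
    · exact Finset.sum_congr rfl fun j _ => by ring
  have he (s : ℝ) : HasDerivAt (fun s : ℝ => ((Real.exp (-ν 0 * s) : ℝ) : ℂ))
      ((-ν 0 * Real.exp (-ν 0 * s) : ℝ) : ℂ) s := (hasDerivAt_exp_mul (-ν 0) s).ofReal_comp
  have hconst := is_const_of_deriv_eq_zero
    (f := fun s : ℝ => ((Real.exp (-ν 0 * s) : ℝ) : ℂ) * (f s - g s))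
    (fun s => ((he s).mul ((hf s).sub (hgd s))).differentiableAt) (fun s => by
      refine ((he s).mul ((hf s).sub (hgd s))).deriv.trans ?_
      simp only [Pi.sub_apply]
      push_cast
      ring) s 0
  have hg0 : g 0 = f 0 := by
    simp [hg, expDivDiff]
  simp only [hg0, sub_self, mul_zero] at hconst
  refine sub_eq_zero.1 ((mul_eq_zero.1 hconst).resolve_left ?_)
  exact_mod_cast (Real.exp_pos _).ne'

/-- Applying `d/ds - ν 0` multiplies the integrand by `t - ν 0` and cancels one pole, matching the
recursion of the divided differences. Cauchy's formula at the last pole gives the top coefficient.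
-/
theorem exists_circleIntegral_eq_sum_expDivDiff (n : ℕ) : ∀ (ν : ℕ → ℝ) (R : ℝ),
    (∀ k ≤ n, |ν k| < R) → ∀ P : ℂ → ℂ, Differentiable ℂ P → ∃ c : ℕ → ℂ, c n = P (ν n) ∧
      ∀ s : ℝ, (2 * (Real.pi : ℂ) * Complex.I)⁻¹ * ∮ t in C(0, R),
        P t / (∏ k ∈ Finset.range (n + 1), (t - ν k)) * Complex.exp (t * s) =
          ∑ j ∈ Finset.range (n + 1), c j * (expDivDiff j ν s : ℂ) := by
  induction n with
  | zero =>
    intro ν R hR P hP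
    refine ⟨fun _ => P (ν 0), rfl, fun s => ?_⟩
    have hmem : (ν 0 : ℂ) ∈ Metric.ball (0 : ℂ) R := by simpa using hR 0 le_rfl
    have hd : Differentiable ℂ fun t => P t * Complex.exp (t * s) := by fun_prop
    have := (hd.diffContOnCl (s := Metric.ball 0 R)).circleIntegral_sub_inv_smul hmem
    rw [show (∮ t in C(0, R), P t / (∏ k ∈ Finset.range (0 + 1), (t - ν k)) *
      Complex.exp (t * s)) = ∮ t in C(0, R), (t - ν 0)⁻¹ • (P t * Complex.exp (t * s)) by
        congr 1 with t
        simp only [zero_add, Finset.prod_range_one, smul_eq_mul]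
        ring, this, smul_eq_mul, inv_mul_cancel_left₀ Complex.two_pi_I_ne_zero]
    simp [expDivDiff]
  | succ n ih =>
    intro ν R hR P hP
    obtain ⟨c, hcn, hc⟩ := ih (fun k => ν (k + 1)) R (fun k hk => hR (k + 1) (by omega)) P hP
    have hR0 : 0 < R := (abs_nonneg _).trans_lt (hR 0 (by omega))
    have hne (k) (hk : k ≤ n + 1) (t : ℂ) (ht : t ∈ Metric.sphere (0 : ℂ) R) : t - ν k ≠ 0 := by
      intro h
      have h1 := hR k hk
      rw [sub_eq_zero.1 h] at ht
      simp only [mem_sphere_zero_iff_norm, Complex.norm_real, Real.norm_eq_abs] at ht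
      exact h1.ne ht
    have hcont : ContinuousOn (fun t : ℂ => P t / (∏ k ∈ Finset.range (n + 1 + 1), (t - ν k)))
        (Metric.sphere 0 R) := by
      refine hP.continuous.continuousOn.div (by fun_prop) fun t ht => ?_
      exact Finset.prod_ne_zero_iff.2 fun k hk => hne k (by simp at hk; omega) t ht
    set f : ℝ → ℂ := fun s => (2 * (Real.pi : ℂ) * Complex.I)⁻¹ * ∮ t in C(0, R),
        P t / (∏ k ∈ Finset.range (n + 1 + 1), (t - ν k)) * Complex.exp (t * s) with hf
    have hfd (s : ℝ) : HasDerivAt f (ν 0 * f s + ∑ j ∈ Finset.range (n + 1),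
        c j * (expDivDiff j (fun k => ν (k + 1)) s : ℂ)) s := by
      refine ((hasDerivAt_circleIntegral_mul_exp hR0.le hcont s).const_mul _).congr_deriv ?_
      rw [← hc s, hf]
      simp only
      rw [mul_left_comm, ← mul_add, ← smul_eq_mul (ν 0 : ℂ), ← circleIntegral.integral_smul,
        ← circleIntegral.integral_add]
      · congr 1
        refine circleIntegral.integral_congr hR0.le fun t ht => ?_
        have h0 := hne 0 (by omega) t ht
        simp only [smul_eq_mul]
        rw [Finset.prod_range_succ' (fun k => t - (ν k : ℂ)) (n + 1)]
        rw [show P t / ∏ k ∈ Finset.range (n + 1), (t - (ν (k + 1) : ℂ)) =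
          (t - ν 0) * (P t / ((∏ k ∈ Finset.range (n + 1), (t - (ν (k + 1) : ℂ))) *
            (t - ν 0))) by field_simp]
        ring
      · refine ContinuousOn.circleIntegrable hR0.le ?_
        simp only [smul_eq_mul]
        exact continuousOn_const.mul (hcont.mul (by fun_prop))
      · refine ContinuousOn.circleIntegrable hR0.le (ContinuousOn.mul ?_ (by fun_prop))
        refine hP.continuous.continuousOn.div (by fun_prop) fun t ht => ?_
        exact Finset.prod_ne_zero_iff.2 fun k hk => hne (k + 1) (by simp at hk; omega) t ht
    -- The initial value becomes the coefficient of index `0` and the old ones move up by one, so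
    -- the top one is unchanged.
    refine ⟨fun j => Nat.casesOn j (f 0) c, hcn, fun s => ?_⟩
    rw [Finset.sum_range_succ' _ (n + 1)]
    exact (eq_sum_expDivDiff_of_hasDerivAt hfd s).trans (add_comm _ _)

theorem exists_exp_eq_sum_expDivDiff (k : ℕ) : ∀ ν : ℕ → ℝ, ∃ c : ℕ → ℂ, ∀ s : ℝ,
    ((Real.exp (ν k * s) : ℝ) : ℂ) =
      ∑ j ∈ Finset.range (k + 1), c j * (expDivDiff j ν s : ℂ) := by
  induction k with
  | zero => exact fun ν => ⟨fun _ => 1, fun s => by simp [expDivDiff]⟩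
  | succ k ih =>
    intro ν
    obtain ⟨c, hc⟩ := ih fun k => ν (k + 1)
    refine ⟨fun j => Nat.casesOn j 1 fun j => ((ν (k + 1) - ν 0 : ℝ) : ℂ) * c j, fun s => ?_⟩
    rw [Finset.sum_range_succ' _ (k + 1)]
    have := eq_sum_expDivDiff_of_hasDerivAt (n := k + 1) (ν := ν)
      (f := fun s => ((Real.exp (ν (k + 1) * s) : ℝ) : ℂ))
      (c := fun j => ((ν (k + 1) - ν 0 : ℝ) : ℂ) * c j) (fun s => by
        refine (hasDerivAt_exp_mul (ν (k + 1)) s).ofReal_comp.congr_deriv ?_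
        simp only [mul_assoc, ← Finset.mul_sum]
        rw [← hc s]
        push_cast
        ring) s
    refine this.trans ((add_comm _ _).trans ?_)
    simp

theorem exists_muntzLegendre_eq_sum_expDivDiff {n : ℕ} {ν : ℕ → ℝ} (hν : ∀ k ≤ n, -1 / 2 < ν k) :
    ∃ c : ℕ → ℂ, c n ≠ 0 ∧ ∀ x : ℝ, 0 < x → muntzLegendre (fun k => (ν k : ℂ)) n x =
      ∑ j ∈ Finset.range (n + 1), c j * (expDivDiff j ν (Real.log x) : ℂ) := by
  obtain ⟨c, hcn, hc⟩ := exists_circleIntegral_eq_sum_expDivDiff n ν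
    (1 + ∑ k ∈ Finset.range (n + 1), ‖(ν k : ℂ)‖) (fun k hk => by
      have := Finset.single_le_sum (f := fun k => ‖(ν k : ℂ)‖) (fun _ _ => norm_nonneg _)
        (Finset.mem_range_succ_iff.2 hk)
      simp only [Complex.norm_real, Real.norm_eq_abs] at this ⊢
      linarith) (fun t => ∏ k ∈ Finset.range n, (t + ν k + 1)) (by fun_prop)
  refine ⟨c, ?_, fun x hx => ?_⟩
  · rw [hcn]
    refine Finset.prod_ne_zero_iff.2 fun k hk => ?_
    have h1 := hν n le_rfl
    have h2 := hν k (Finset.mem_range.1 hk).le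
    have : ν n + ν k + 1 ≠ 0 := by linarith
    exact_mod_cast this
  · rw [← hc]
    unfold muntzLegendre
    congr 2 with t
    rw [Complex.cpow_def_of_ne_zero (by exact_mod_cast hx.ne'), ← Complex.ofReal_log hx.le,
      mul_comm (Real.log x : ℂ)]
    congr 1
    simp only [muntzW, Complex.conj_ofReal, Finset.prod_range_succ, Finset.prod_div_distrib]
    rw [div_mul_div_comm, mul_one]

/-! ### Integrability, continuity and positivity of the moments. -/

theorem abs_expDivDiff_le (j : ℕ) : ∀ (ν : ℕ → ℝ) (m : ℝ), (∀ k ≤ j, m ≤ ν k) → ∀ s ≤ 0,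
    |expDivDiff j ν s| ≤ |s| ^ j * Real.exp (m * s) := by
  induction j with
  | zero =>
    intro ν m hm s hs
    simp only [expDivDiff, Real.abs_exp, pow_zero, one_mul]
    exact Real.exp_le_exp.2 (mul_le_mul_of_nonpos_right (hm 0 le_rfl) hs)
  | succ j ih =>
    intro ν m hm s hs
    have h : ∀ u ∈ Set.uIoc 0 s,
        ‖Real.exp (ν 0 * (s - u)) * expDivDiff j (fun k => ν (k + 1)) u‖ ≤
          |s| ^ j * Real.exp (m * s) := by
      intro u hu
      rw [Set.uIoc_of_ge hs] at hu
      have h1 := ih (fun k => ν (k + 1)) m (fun k hk => hm (k + 1) (by omega)) u hu.2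
      have h2 : Real.exp (ν 0 * (s - u)) ≤ Real.exp (m * (s - u)) :=
        Real.exp_le_exp.2 (mul_le_mul_of_nonpos_right (hm 0 (by omega)) (by linarith [hu.1]))
      have h3 : |u| ≤ |s| := by
        rw [abs_of_nonpos hs, abs_of_nonpos hu.2]; linarith [hu.1]
      rw [norm_mul, Real.norm_eq_abs, Real.abs_exp, Real.norm_eq_abs]
      calc _ ≤ Real.exp (m * (s - u)) * (|s| ^ j * Real.exp (m * u)) := by
            refine mul_le_mul h2 (h1.trans ?_) (abs_nonneg _) (Real.exp_pos _).le
            gcongr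
        _ = |s| ^ j * (Real.exp (m * (s - u)) * Real.exp (m * u)) := by ring
        _ = _ := by rw [← Real.exp_add]; ring_nf
    have := intervalIntegral.norm_integral_le_of_norm_le_const h
    rw [sub_zero, Real.norm_eq_abs] at this
    calc _ ≤ _ := this
      _ = _ := by ring

/-- The power of `|log x|` is absorbed into `x ^ (-δ)` through `t ^ j / j! ≤ exp t` at `t = δ * |log
x|`. -/
theorem abs_expDivDiff_log_mul_rpow_le {j : ℕ} {ν : ℕ → ℝ} {m δ β : ℝ} (hδ : 0 < δ)
    (hm : ∀ k ≤ j, m ≤ ν k) {x : ℝ} (hx : x ∈ Set.Ioc (0 : ℝ) 1) :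
    |expDivDiff j ν (Real.log x) * x ^ (β / 2)| ≤ j.factorial / δ ^ j * x ^ (m + β / 2 - δ) := by
  have hs : Real.log x ≤ 0 := Real.log_nonpos hx.1.le hx.2
  have h1 := abs_expDivDiff_le j ν m hm _ hs
  have h2 := Real.pow_div_factorial_le_exp (δ * |Real.log x|) (by positivity) j
  have h3 : |Real.log x| ^ j ≤ j.factorial / δ ^ j * Real.exp (δ * |Real.log x|) := by
    rw [mul_pow, div_le_iff₀ (by positivity)] at h2
    rw [div_mul_eq_mul_div, le_div_iff₀ (by positivity)]
    linarith
  rw [abs_mul, abs_of_nonneg (Real.rpow_nonneg hx.1.le _), Real.rpow_def_of_pos hx.1,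
    Real.rpow_def_of_pos hx.1]
  calc _ ≤ j.factorial / δ ^ j * Real.exp (δ * |Real.log x|) * Real.exp (m * Real.log x) *
        Real.exp (Real.log x * (β / 2)) := by gcongr; exact h1.trans (by gcongr)
    _ = j.factorial / δ ^ j * (Real.exp (δ * |Real.log x|) * Real.exp (m * Real.log x) *
        Real.exp (Real.log x * (β / 2))) := by ring
    _ = _ := by
      rw [← Real.exp_add, ← Real.exp_add, abs_of_nonpos hs]
      ring_nf

theorem measurable_expDivDiff_log_mul_rpow (j : ℕ) (ν : ℕ → ℝ) (β : ℝ) :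
    Measurable fun x : ℝ => expDivDiff j ν (Real.log x) * x ^ (β / 2) :=
  ((continuous_expDivDiff_right j ν).measurable.comp Real.measurable_log).mul
    (measurable_id.pow_const _)

theorem exists_lt_forall_le (n : ℕ) {ν : ℕ → ℝ} {a : ℝ} (h : ∀ k ≤ n, a < ν k) :
    ∃ m, a < m ∧ ∀ k ≤ n, m ≤ ν k := by
  obtain ⟨k, hk, hmin⟩ := (Finset.range (n + 1)).exists_min_image ν ⟨0, by simp⟩
  exact ⟨ν k, h k (by simpa [Nat.lt_succ_iff] using hk), fun i hi =>
    hmin i (Finset.mem_range_succ_iff.2 hi)⟩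

/-- Taking `δ` to be half the gap `m + β / 2 + 1` keeps the exponent above `-1`. The majorant
depends on the exponents only through `m`, as dominated convergence in `α` needs. -/
theorem intervalIntegrable_rpow_majorant {m β : ℝ} (hm : -1 < m + β / 2) (j : ℕ) :
    IntervalIntegrable (fun x : ℝ => j.factorial / ((m + β / 2 + 1) / 2) ^ j *
      x ^ (m + β / 2 - (m + β / 2 + 1) / 2)) MeasureTheory.volume 0 1 :=
  (intervalIntegral.intervalIntegrable_rpow' (by linarith)).const_mul _

theorem intervalIntegrable_expDivDiff_log {j : ℕ} {ν : ℕ → ℝ} {β : ℝ}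
    (hν : ∀ k ≤ j, -1 - β / 2 < ν k) :
    IntervalIntegrable (fun x : ℝ => expDivDiff j ν (Real.log x) * x ^ (β / 2))
      MeasureTheory.volume 0 1 := by
  obtain ⟨m, hm, hle⟩ := exists_lt_forall_le j hν
  refine (intervalIntegrable_rpow_majorant (m := m) (β := β) (by linarith) j).mono_fun'
    (measurable_expDivDiff_log_mul_rpow j ν β).aestronglyMeasurable ?_
  refine (MeasureTheory.ae_restrict_iff' measurableSet_uIoc).2 (Eventually.of_forall fun x hx => ?_)
  rw [Set.uIoc_of_le zero_le_one] at hx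
  exact abs_expDivDiff_log_mul_rpow_le (by linarith) hle hx

/-- The moments of the basis functions with respect to `x ^ (β / 2) dx`, where `s = log x`. -/
def expMoment (β : ℝ) (ν : ℕ → ℝ) (j : ℕ) : ℝ :=
  ∫ x in (0 : ℝ)..1, expDivDiff j ν (Real.log x) * x ^ (β / 2)

theorem continuousOn_expMoment {β m : ℝ} (hm : -1 < m + β / 2) (j : ℕ) {ν : ℝ → ℕ → ℝ}
    (hν : Continuous ν) {S : Set ℝ} (hle : ∀ α ∈ S, ∀ k ≤ j, m ≤ ν α k) :
    ContinuousOn (fun α => expMoment β (ν α) j) S := by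
  intro α₀ _
  refine intervalIntegral.continuousWithinAt_of_dominated_interval
    (Eventually.of_forall fun α => (measurable_expDivDiff_log_mul_rpow j (ν α) β).aestronglyMeasurable)
    ?_ (intervalIntegrable_rpow_majorant hm j) ?_
  · filter_upwards [self_mem_nhdsWithin] with α hα
    refine Eventually.of_forall fun x hx => ?_
    rw [Set.uIoc_of_le zero_le_one] at hx
    exact abs_expDivDiff_log_mul_rpow_le (by linarith) (hle α hα) hx
  · refine Eventually.of_forall fun x _ => Continuous.continuousWithinAt ?_
    refine Continuous.mul ?_ continuous_const
    exact (continuous_expDivDiff j).comp (hν.prodMk continuous_const)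

theorem isPositiveMoments_expMoment {n : ℕ} {β : ℝ} {ν : ℕ → ℝ}
    (hν : ∀ k < n, -1 - β / 2 < ν k) : IsPositiveMoments n ν (fun j => expMoment β ν j) := by
  intro c hc hF
  set f : ℝ → ℝ := fun x => expPoly n ν c (Real.log x) * x ^ (β / 2) with hf
  have hsum : f = fun x => ∑ j : Fin n, c j * (expDivDiff j ν (Real.log x) * x ^ (β / 2)) := by
    ext x
    simp only [hf, expPoly, Finset.sum_mul, mul_assoc]
  have hint (j : Fin n) : IntervalIntegrable
      (fun x => c j * (expDivDiff j ν (Real.log x) * x ^ (β / 2))) MeasureTheory.volume 0 1 :=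
    (intervalIntegrable_expDivDiff_log fun k hk => hν k (hk.trans_lt j.2)).const_mul _
  have hfint : IntervalIntegrable f MeasureTheory.volume 0 1 := by
    rw [hsum]
    simpa [Finset.sum_fn] using IntervalIntegrable.sum (Finset.univ) fun j _ => hint j
  have heq : ∑ j : Fin n, c j * expMoment β ν j = ∫ x in (0 : ℝ)..1, f x := by
    rw [hsum, intervalIntegral.integral_finsetSum fun j _ => hint j]
    simp [expMoment]
  rw [heq]
  have hnonneg (x : ℝ) (hx : x ∈ Set.Ioc (0 : ℝ) 1) : 0 ≤ f x :=
    mul_nonneg (hF _ (Real.log_nonpos hx.1.le hx.2)) (Real.rpow_nonneg hx.1.le _)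
  obtain ⟨s, hs, hs0⟩ : ∃ s < 0, expPoly n ν c s ≠ 0 := by
    by_contra! h
    obtain ⟨T, hT, hcard⟩ := (Set.Iio_infinite (0 : ℝ)).exists_subset_card_eq n
    exact hc (expPoly_eq_zero_of_zeros ν c T hcard.ge fun t ht => h t (hT ht))
  -- Cutting at `a > 0` avoids the singularity of `log` at `0`; strict positivity comes from the
  -- point `exp s` in `[a, 1]`.
  set a := Real.exp s / 2 with ha
  have hes : Real.exp s < 1 := by simpa using hs
  have ha0 : 0 < a := by positivity
  have ha1 : a < 1 := by linarith
  have hI1 : IntervalIntegrable f MeasureTheory.volume 0 a := hfint.mono_set (by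
    rw [Set.uIcc_of_le ha0.le, Set.uIcc_of_le zero_le_one]; exact Set.Icc_subset_Icc_right ha1.le)
  have hI2 : IntervalIntegrable f MeasureTheory.volume a 1 := hfint.mono_set (by
    rw [Set.uIcc_of_le ha1.le, Set.uIcc_of_le zero_le_one]; exact Set.Icc_subset_Icc_left ha0.le)
  rw [← intervalIntegral.integral_add_adjacent_intervals hI1 hI2]
  refine add_pos_of_nonneg_of_pos ?_ ?_
  · rw [intervalIntegral.integral_of_le ha0.le]
    exact MeasureTheory.setIntegral_nonneg measurableSet_Ioc fun x hx =>
      hnonneg x ⟨hx.1, hx.2.trans ha1.le⟩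
  · refine intervalIntegral.integral_pos ha1 (fun x hx => ContinuousAt.continuousWithinAt ?_)
      (fun x hx => hnonneg x ⟨ha0.trans hx.1, hx.2⟩) ⟨Real.exp s, ⟨by linarith, hes.le⟩, ?_⟩
    · have hx0 : x ≠ 0 := (ha0.trans_le hx.1).ne'
      exact ((continuous_expPoly_right n ν c).continuousAt.comp (Real.continuousAt_log hx0)).mul
        (Real.continuousAt_rpow_const _ _ (Or.inl hx0))
    · rw [hf]
      simp only [Real.log_exp]
      exact mul_pos ((hF s hs.le).lt_of_ne' hs0) (Real.rpow_pos_of_pos (Real.exp_pos _) _)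

/-! ### Translating Gauss rules into moment equations. -/

theorem neg_one_sub_half_lt {β a : ℝ} (hβ : -1 < β) (ha : -1 / 2 < a) : -1 - β / 2 < a := by
  linarith

theorem exists_muntzJacobi_eq_sum_expDivDiff {n : ℕ} {β : ℝ} {lam : ℕ → ℝ} (hβ : -1 < β)
    (hlam : ∀ k ≤ n, -1 / 2 < lam k + β / 2) : ∃ c : ℕ → ℂ, c n ≠ 0 ∧
      (∀ x : ℝ, 0 < x → muntzJacobi β lam n x = ((x ^ (-β / 2) : ℝ) : ℂ) *
        ∑ j ∈ Finset.range (n + 1),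
          c j * (expDivDiff j (fun k => lam k + β / 2) (Real.log x) : ℂ)) ∧
      IntervalIntegrable (fun t : ℝ => muntzJacobi β lam n t * ((t ^ β : ℝ) : ℂ))
        MeasureTheory.volume 0 1 ∧
      muntzMoment β lam n = ∑ j ∈ Finset.range (n + 1),
        c j * (expMoment β (fun k => lam k + β / 2) j : ℂ) := by
  obtain ⟨c, hcn, hc⟩ := exists_muntzLegendre_eq_sum_expDivDiff
    (ν := fun k => lam k + β / 2) hlam
  have hJ (x : ℝ) (hx : 0 < x) : muntzJacobi β lam n x = ((x ^ (-β / 2) : ℝ) : ℂ) *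
      ∑ j ∈ Finset.range (n + 1),
        c j * (expDivDiff j (fun k => lam k + β / 2) (Real.log x) : ℂ) := by
    rw [muntzJacobi, hc x hx]
  have hEq : Set.EqOn (fun x : ℝ => ∑ j ∈ Finset.range (n + 1), c j *
      ((expDivDiff j (fun k => lam k + β / 2) (Real.log x) * x ^ (β / 2) : ℝ) : ℂ))
      (fun x : ℝ => muntzJacobi β lam n x * ((x ^ β : ℝ) : ℂ)) (Set.uIoc 0 1) := by
    intro x hx
    rw [Set.uIoc_of_le zero_le_one] at hx
    simp only
    rw [hJ x hx.1, mul_right_comm, ← Complex.ofReal_mul, ← Real.rpow_add hx.1,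
      show -β / 2 + β = β / 2 by ring, Finset.mul_sum]
    refine Finset.sum_congr rfl fun j _ => ?_
    push_cast
    ring
  have hint (j) (hj : j ∈ Finset.range (n + 1)) : IntervalIntegrable (fun x : ℝ => c j *
      ((expDivDiff j (fun k => lam k + β / 2) (Real.log x) * x ^ (β / 2) : ℝ) : ℂ))
      MeasureTheory.volume 0 1 := by
    refine IntervalIntegrable.const_mul ?_ _
    have := intervalIntegrable_expDivDiff_log (j := j) (β := β) (ν := fun k => lam k + β / 2)
      fun k hk => neg_one_sub_half_lt hβ (hlam k (by simp at hj; omega))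
    exact ⟨this.1.ofReal, this.2.ofReal⟩
  refine ⟨c, hcn, hJ, IntervalIntegrable.congr hEq ?_, ?_⟩
  · simpa [Finset.sum_fn] using IntervalIntegrable.sum (Finset.range (n + 1)) hint
  · rw [muntzMoment, ← intervalIntegral.integral_congr_ae (Eventually.of_forall fun _ hx => hEq hx),
      intervalIntegral.integral_finsetSum hint]
    refine Finset.sum_congr rfl fun j _ => ?_
    rw [intervalIntegral.integral_const_mul, intervalIntegral.integral_ofReal, expMoment]

/-- Exactness on the Müntz–Jacobi polynomials is exactness on the divided differences. -/
theorem isMuntzGaussRule_iff {N : ℕ} {β : ℝ} {lam : ℕ → ℝ} (hβ : -1 < β)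
    (hlam : ∀ n ≤ 2 * N + 1, -1 / 2 < lam n + β / 2) {x w : Fin (N + 1) → ℝ} (hx : ∀ k, 0 < x k) :
    IsMuntzGaussRule N β lam x w ↔
      (fun k => Real.log (x k), fun k => w k * x k ^ (-β / 2)) ∈ quadDomain N ∧
      quadMoments N (fun k => lam k + β / 2)
        (fun k => Real.log (x k), fun k => w k * x k ^ (-β / 2)) =
          fun j : Fin (2 * N + 2) => expMoment β (fun k => lam k + β / 2) j := by
  set ν : ℕ → ℝ := fun k => lam k + β / 2
  have hpos (k) : 0 < x k ^ (-β / 2) := Real.rpow_pos_of_pos (hx k) _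
  choose! c hcn hJ hint hmom using fun n (hn : n ≤ 2 * N + 1) =>
    exists_muntzJacobi_eq_sum_expDivDiff (n := n) hβ fun k hk => hlam k (hk.trans hn)
  let err : ℕ → ℝ := fun j =>
    ∑ k, w k * x k ^ (-β / 2) * expDivDiff j ν (Real.log (x k)) - expMoment β ν j
  have hexact (n) (hn : n ≤ 2 * N + 1) :
      ∑ k, muntzJacobi β lam n (x k) * ((w k : ℝ) : ℂ) - muntzMoment β lam n =
        ∑ j ∈ Finset.range (n + 1), c n j * (err j : ℂ) := by
    have h1 (k) : muntzJacobi β lam n (x k) * ((w k : ℝ) : ℂ) = ∑ j ∈ Finset.range (n + 1),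
        c n j * ((w k * x k ^ (-β / 2) * expDivDiff j ν (Real.log (x k)) : ℝ) : ℂ) := by
      rw [hJ n hn _ (hx k), mul_right_comm, Finset.mul_sum]
      refine Finset.sum_congr rfl fun j _ => ?_
      push_cast
      ring
    simp only [h1, hmom n hn, err, Complex.ofReal_sub, mul_sub, Finset.sum_sub_distrib,
      Complex.ofReal_sum, Finset.mul_sum]
    rw [Finset.sum_comm]
  have herr : (∀ n ≤ 2 * N + 1, ∑ k, muntzJacobi β lam n (x k) * ((w k : ℝ) : ℂ) =
      muntzMoment β lam n) ↔ ∀ n ≤ 2 * N + 1, err n = 0 := by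
    refine ⟨fun h n => ?_, fun h n hn => ?_⟩
    · induction n using Nat.strong_induction_on with
      | _ n ih =>
        intro hn
        -- Forward substitution: with the earlier errors zero, only the diagonal term `c n n * err
        -- n` remains.
        have h1 := hexact n hn
        rw [h n hn, sub_self, Finset.sum_range_succ, Finset.sum_eq_zero, zero_add] at h1
        · exact_mod_cast (mul_eq_zero.1 h1.symm).resolve_left (hcn n hn)
        · intro j hj
          have hj' := Finset.mem_range.1 hj
          rw [ih j hj' (by omega)]
          simp
    · refine sub_eq_zero.1 ((hexact n hn).trans (Finset.sum_eq_zero fun j hj => ?_))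
      rw [h j (by simp at hj; omega)]
      simp
  have hmoments : (∀ n ≤ 2 * N + 1, err n = 0) ↔
      quadMoments N ν (fun k => Real.log (x k), fun k => w k * x k ^ (-β / 2)) =
        fun j : Fin (2 * N + 2) => expMoment β ν j := by
    refine ⟨fun h => funext fun j => sub_eq_zero.1 (h j (by omega)), fun h n hn => ?_⟩
    exact sub_eq_zero.2 (congrFun h ⟨n, by omega⟩)
  rw [← hmoments, ← herr]
  constructor
  · intro h
    refine ⟨⟨fun i j hij => Real.log_lt_log (hx i) (h.node_strictMono hij),
      fun k => Real.log_neg (hx k) (h.node_mem k).2, fun k => mul_pos (h.weight_pos k) (hpos k)⟩,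
      h.exact⟩
  · rintro ⟨⟨h1, h2, h3⟩, h4⟩
    refine ⟨fun k => ⟨hx k, ?_⟩, fun i j hij => ?_, fun k => ?_, hint, h4⟩
    · exact (Real.log_neg_iff (hx k)).1 (h2 k)
    · exact (Real.log_lt_log_iff (hx i) (hx j)).1 (h1 hij)
    · exact pos_of_mul_pos_left (h3 k) (hpos k).le

/-! ### The Gauss–Jacobi endpoint. -/

/-- A rule that is exact on the powers up to degree `2 N + 1` is the Gauss–Jacobi rule. -/
theorem isGaussJacobiRule_of_exact {N : ℕ} {β : ℝ} (hβ : -1 < β) {x w : Fin (N + 1) → ℝ}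
    (hx : Function.Injective x)
    (h : ∀ n ≤ 2 * N + 1, ∑ k, w k * x k ^ n = ∫ t in (0 : ℝ)..1, t ^ n * t ^ β) :
    IsGaussJacobiRule N β x w := by
  have hint (n : ℕ) : IntervalIntegrable (fun t : ℝ => t ^ n * t ^ β) MeasureTheory.volume 0 1 :=
    (intervalIntegral.intervalIntegrable_rpow' hβ).continuousOn_mul (by fun_prop)
  have hpoly (p : Polynomial ℝ) (hp : p.natDegree ≤ 2 * N + 1) :
      ∑ k, w k * p.eval (x k) = ∫ t in (0 : ℝ)..1, p.eval t * t ^ β := by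
    simp only [Polynomial.eval_eq_sum_range, Finset.sum_mul, mul_assoc, Finset.mul_sum]
    rw [intervalIntegral.integral_finsetSum fun n _ => (hint n).const_mul _, Finset.sum_comm]
    refine Finset.sum_congr rfl fun n hn => ?_
    rw [intervalIntegral.integral_const_mul, ← h n (by simp at hn; omega), Finset.mul_sum]
    exact Finset.sum_congr rfl fun k _ => by ring
  let P : Polynomial ℝ :=
    ((Finset.univ.val.map x).map fun a => Polynomial.X - Polynomial.C a).prod
  have hroots : P.roots = Finset.univ.val.map x := Polynomial.roots_multiset_prod_X_sub_C _
  have hdeg : P.natDegree = N + 1 := by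
    rw [Polynomial.natDegree_multiset_prod_X_sub_C_eq_card]; simp
  refine ⟨hx, ⟨P, hdeg, fun q hq => ?_, hroots⟩, fun k => ?_⟩
  · have hPq := hpoly (P * q) (Polynomial.natDegree_mul_le.trans (by omega))
    simp only [Polynomial.eval_mul] at hPq
    rw [← hPq]
    refine Finset.sum_eq_zero fun k _ => ?_
    have : P.eval (x k) = 0 := by
      refine Polynomial.isRoot_of_mem_roots (p := P) ?_
      rw [hroots]
      exact Multiset.mem_map_of_mem x (Finset.mem_univ k)
    rw [this, zero_mul, mul_zero]
  · have hd : (Lagrange.basis Finset.univ x k).natDegree ≤ 2 * N + 1 := by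
      have := Lagrange.degree_basis (s := Finset.univ) hx.injOn (Finset.mem_univ k)
      rw [Polynomial.natDegree_eq_of_degree_eq_some this]
      simp
      omega
    rw [← hpoly _ hd, Finset.sum_eq_single k]
    · rw [Lagrange.eval_basis_self hx.injOn (Finset.mem_univ k), mul_one]
    · intro i _ hik
      rw [Lagrange.eval_basis_of_ne hik.symm (Finset.mem_univ i), mul_zero]
    · simp

theorem sum_mul_exp_eq_integral {N : ℕ} {β : ℝ} {ν : ℕ → ℝ} (hν : ∀ k ≤ 2 * N + 1, -1 - β / 2 < ν k)
    {p : (Fin (N + 1) → ℝ) × (Fin (N + 1) → ℝ)}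
    (hp : quadMoments N ν p = fun j : Fin (2 * N + 2) => expMoment β ν j) {n : ℕ} (hn : n ≤ 2 * N + 1) :
    ∑ k, p.2 k * Real.exp (ν n * p.1 k) =
      ∫ x in (0 : ℝ)..1, Real.exp (ν n * Real.log x) * x ^ (β / 2) := by
  obtain ⟨c, hc⟩ := exists_exp_eq_sum_expDivDiff n ν
  have hint (j) (hj : j ∈ Finset.range (n + 1)) : IntervalIntegrable (fun x : ℝ => c j *
      ((expDivDiff j ν (Real.log x) * x ^ (β / 2) : ℝ) : ℂ)) MeasureTheory.volume 0 1 := by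
    have := intervalIntegrable_expDivDiff_log (j := j) (β := β) (ν := ν)
      fun k hk => hν k (by simp at hj; omega)
    exact IntervalIntegrable.const_mul ⟨this.1.ofReal, this.2.ofReal⟩ _
  apply Complex.ofReal_injective
  rw [← intervalIntegral.integral_ofReal]
  have h1 (x : ℝ) : ((Real.exp (ν n * Real.log x) * x ^ (β / 2) : ℝ) : ℂ) =
      ∑ j ∈ Finset.range (n + 1), c j * ((expDivDiff j ν (Real.log x) * x ^ (β / 2) : ℝ) : ℂ) := by
    rw [Complex.ofReal_mul, hc, Finset.sum_mul]
    exact Finset.sum_congr rfl fun j _ => by push_cast; ring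
  simp only [h1]
  rw [intervalIntegral.integral_finsetSum hint, Complex.ofReal_sum]
  simp only [Complex.ofReal_mul, hc, Finset.mul_sum]
  rw [Finset.sum_comm]
  refine Finset.sum_congr rfl fun j hj => ?_
  rw [intervalIntegral.integral_const_mul]
  simp only [← Complex.ofReal_mul]
  rw [intervalIntegral.integral_ofReal]
  have h2 : expMoment β ν j = quadMoments N ν p ⟨j, by simp at hj; omega⟩ := by rw [hp]
  rw [show (∫ x in (0 : ℝ)..1, expDivDiff j ν (Real.log x) * x ^ (β / 2)) = expMoment β ν j from rfl,
    h2, quadMoments, Complex.ofReal_sum, Finset.mul_sum]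
  refine Finset.sum_congr rfl fun k _ => ?_
  push_cast
  ring

/-! ### The continuity theorem. -/

theorem mainTheorem5 (N : ℕ) (β : ℝ) (hβ : -1 < β) (lam : ℕ → ℝ)
    (hlam : ∀ n ≤ 2 * N + 1, -1 / 2 < lam n + β / 2) :
    ∃ x w : ℝ → Fin (N + 1) → ℝ,
      (∀ α ∈ Set.Icc (0 : ℝ) 1,
        IsMuntzGaussRule N β (muntzHomotopy lam α) (x α) (w α) ∧
        ∀ x' w' : Fin (N + 1) → ℝ,
          IsMuntzGaussRule N β (muntzHomotopy lam α) x' w' → x' = x α ∧ w' = w α) ∧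
      (∀ k, ContinuousOn (fun α => x α k) (Set.Icc 0 1)) ∧
      (∀ k, ContinuousOn (fun α => w α k) (Set.Icc 0 1)) ∧
      IsGaussJacobiRule N β (x 0) (w 0) ∧
      IsMuntzGaussRule N β lam (x 1) (w 1) := by
  let ν : ℝ → ℕ → ℝ := fun α k => muntzHomotopy lam α k + β / 2
  have hνc : Continuous ν := by
    refine continuous_pi fun k => ?_
    simp only [ν, muntzHomotopy]
    fun_prop
  obtain ⟨m, hm, hmle⟩ : ∃ m, -1 / 2 < m ∧
      ∀ α ∈ Set.Icc (0 : ℝ) 1, ∀ k ≤ 2 * N + 1, m ≤ ν α k := by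
    obtain ⟨m, hm, hle⟩ := exists_lt_forall_le (2 * N + 1) hlam
    -- The exponents at `α = 0` are `k + β / 2 ≥ β / 2 > -1/2`; convexity extends the bound to all
    -- `α`.
    refine ⟨min m (β / 2), lt_min hm (by linarith), fun α hα k hk => ?_⟩
    have h1 : α * min m (β / 2) ≤ α * (lam k + β / 2) :=
      mul_le_mul_of_nonneg_left ((min_le_left _ _).trans (hle k hk)) hα.1
    have h2 : (1 - α) * min m (β / 2) ≤ (1 - α) * (k + β / 2) :=
      mul_le_mul_of_nonneg_left ((min_le_right _ _).trans (by simp)) (sub_nonneg.2 hα.2)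
    simp only [ν, muntzHomotopy]
    linarith
  have hν (α) (hα : α ∈ Set.Icc (0 : ℝ) 1) (k) (hk : k ≤ 2 * N + 1) : -1 / 2 < ν α k :=
    hm.trans_le (hmle α hα k hk)
  have hpos (α) (hα : α ∈ Set.Icc (0 : ℝ) 1) :
      IsPositiveMoments (2 * N + 2) (ν α) (fun j : Fin (2 * N + 2) => expMoment β (ν α) j) :=
    isPositiveMoments_expMoment fun k hk => neg_one_sub_half_lt hβ (hν α hα k (by omega))
  choose! p hp hpm using fun α hα => exists_quadMoments_eq (hpos α hα)
  have hcont : ContinuousOn p (Set.Icc 0 1) := by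
    intro α₀ hα₀
    -- Along any ultrafilter the rules converge to a rule with the moments at `α₀`, which is `p α₀`
    -- by uniqueness.
    refine tendsto_iff_ultrafilter _ _ _ |>.2 fun 𝒰 hU => ?_
    have hmem : ∀ᶠ α in (𝒰 : Filter ℝ), α ∈ Set.Icc (0 : ℝ) 1 :=
      hU self_mem_nhdsWithin
    have hνlim : Tendsto ν 𝒰 (𝓝 (ν α₀)) :=
      (hνc.tendsto α₀).mono_left (hU.trans nhdsWithin_le_nhds)
    have hy : Tendsto (fun α => quadMoments N (ν α) (p α)) 𝒰
        (𝓝 fun j : Fin (2 * N + 2) => expMoment β (ν α₀) j) := by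
      have h1 : Tendsto (fun α (j : Fin (2 * N + 2)) => expMoment β (ν α) j) 𝒰
          (𝓝 fun j : Fin (2 * N + 2) => expMoment β (ν α₀) j) := tendsto_pi_nhds.2 fun j =>
        (continuousOn_expMoment (m := m) (by linarith) j hνc
          (fun α hα k hk => hmle α hα k (by omega)) α₀ hα₀).mono_left hU
      exact h1.congr' (hmem.mono fun α hα => (hpm α hα).symm)
    obtain ⟨p₀, hp₀, hlim⟩ := exists_tendsto_of_tendsto_quadMoments hνlim
      (hmem.mono fun α hα => hp α hα) hy (hpos α₀ hα₀)
    have h2 : quadMoments N (ν α₀) p₀ = fun j : Fin (2 * N + 2) => expMoment β (ν α₀) j :=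
      tendsto_nhds_unique (((continuous_quadMoments N).tendsto (ν α₀, p₀)).comp
        (hνlim.prodMk_nhds hlim)) hy
    rwa [injOn_quadMoments N (ν α₀) hp₀ (hp α₀ hα₀) (h2.trans (hpm α₀ hα₀).symm)] at hlim
  let x : ℝ → Fin (N + 1) → ℝ := fun α k => Real.exp ((p α).1 k)
  let w : ℝ → Fin (N + 1) → ℝ := fun α k => (p α).2 k * Real.exp (β / 2 * (p α).1 k)
  have hx0 (α k) : 0 < x α k := Real.exp_pos _
  have hback (α) : ((fun k => Real.log (x α k), fun k => w α k * x α k ^ (-β / 2)) :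
      (Fin (N + 1) → ℝ) × (Fin (N + 1) → ℝ)) = p α := by
    refine Prod.ext (funext fun k => Real.log_exp _) (funext fun k => ?_)
    simp only [x, w]
    rw [← Real.exp_mul, mul_assoc, ← Real.exp_add,
      show β / 2 * (p α).1 k + (p α).1 k * (-β / 2) = 0 by ring, Real.exp_zero, mul_one]
  have hrule (α) (hα : α ∈ Set.Icc (0 : ℝ) 1) :
      IsMuntzGaussRule N β (muntzHomotopy lam α) (x α) (w α) := by
    rw [isMuntzGaussRule_iff hβ (hν α hα) (hx0 α), hback]
    exact ⟨hp α hα, hpm α hα⟩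
  refine ⟨x, w, fun α hα => ⟨hrule α hα, fun x' w' h' => ?_⟩, fun k => ?_, fun k => ?_, ?_, ?_⟩
  · have hx' (k) : 0 < x' k := (h'.node_mem k).1
    obtain ⟨h1, h2⟩ := (isMuntzGaussRule_iff hβ (hν α hα) hx').1 h'
    have h3 := injOn_quadMoments N (ν α) h1 (hp α hα) (h2.trans (hpm α hα).symm)
    rw [← hback α, Prod.mk.injEq] at h3
    have hxx : x' = x α := funext fun k => Real.log_injOn_pos (hx' k) (hx0 α k) (congrFun h3.1 k)
    refine ⟨hxx, funext fun k => ?_⟩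
    have h4 := congrFun h3.2 k
    rw [hxx] at h4
    exact mul_right_cancel₀ (Real.rpow_pos_of_pos (hx0 α k) _).ne' h4
  · exact Real.continuous_exp.comp_continuousOn
      ((continuous_apply k).comp_continuousOn (continuous_fst.comp_continuousOn hcont))
  · have h1 : ContinuousOn (fun α => (p α).1 k) (Set.Icc 0 1) :=
      (continuous_apply k).comp_continuousOn (continuous_fst.comp_continuousOn hcont)
    have h2 : ContinuousOn (fun α => (p α).2 k) (Set.Icc 0 1) :=
      (continuous_apply k).comp_continuousOn (continuous_snd.comp_continuousOn hcont)
    exact h2.mul (Real.continuous_exp.comp_continuousOn (continuousOn_const.mul h1))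
  · have h0 : (0 : ℝ) ∈ Set.Icc (0 : ℝ) 1 := Set.left_mem_Icc.2 zero_le_one
    refine isGaussJacobiRule_of_exact hβ (hrule 0 h0).node_strictMono.injective fun n hn => ?_
    have h1 := sum_mul_exp_eq_integral
      (fun k hk => neg_one_sub_half_lt hβ (hν 0 h0 k hk)) (hpm 0 h0) hn
    have hν0 : ν 0 n = n + β / 2 := by simp [ν, muntzHomotopy]
    rw [hν0] at h1
    refine Eq.trans (Finset.sum_congr rfl fun k _ => ?_) (h1.trans ?_)
    · simp only [x, w]
      rw [← Real.exp_nat_mul, mul_assoc, ← Real.exp_add]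
      ring_nf
    · refine intervalIntegral.integral_congr_ae (Eventually.of_forall fun t ht => ?_)
      rw [Set.uIoc_of_le zero_le_one] at ht
      rw [mul_comm ((n : ℝ) + β / 2), ← Real.rpow_def_of_pos ht.1, ← Real.rpow_add ht.1,
        ← Real.rpow_natCast t n, ← Real.rpow_add ht.1]
      ring_nf
  · have h1 : muntzHomotopy lam 1 = lam := by
      ext n
      simp [muntzHomotopy]
    have h2 := hrule 1 (Set.right_mem_Icc.2 zero_le_one)
    rwa [h1] at h2

end
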